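/- All graphs are finite, nonnull and loopless; multiple edges are allowed. For a graph $G$, $d_G(v)$ denotes the number of edges incident with the vertex $v$. For an integer $k\ge 1$, $G$ is $k$-edge-connected if it remains connected after the removal of any set of fewer than $k$ edges (so a one-vertex graph is $k$-edge-connected for every $k$). A closed walk $v_0,e_1,v_1,\dots,e_n,v_n=v_0$ with $n\ge 1$ meets a vertex $v$ exactly $|\{i : 1\le i\le n,\ v_i=v\}|$ times; the trivial closed walk ($n=0$) meets its vertex once. A trail is a walk without repeated edges, and a closed walk or trail is spanning if it meets every vertex of $G$. Let $G$ be a graph. 1. Let $k\ge 4$ be an integer. If $G$ is $k$-edge-connected, then $G$ has a spanning closed trail that meets each vertex $v$ at most $\left\lceil\frac{d_G(v)+k/2-4}{k}\right\rceil+1$ times. 2. Let $k\in\{1,2,3\}$, and if $k=1$ assume that $G$ has at least two vertices. If $G$ is $k$-edge-connected, then $G$ has a spanning closed walk that meets each vertex $v$ at most $\left\lceil\frac{d_G(v)-1}{k}\right\rceil+1$ times. 3. Let $4\le r\le 8$ be an integer. If $G$ is $r$-edge-connected and $r$-regular, then $G$ has a connected $\{2,4\}$-factor, that is, a connected spanning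 subgraph in which every vertex has degree $2$ or $4$. -/

import Mathlib

/-! Multigraphs are Mathlib's `Graph α β`: parallel edges are allowed, and loops are excluded by
the class `Graph.Loopless`. -/

open scoped Graph

universe u v

namespace Graph

/-- The degree of a vertex: the number of edges incident with it. (In a loopless finite graph, this
is the usual degree.) -/
noncomputable def degree {α : Type u} {β : Type v} (G : Graph α β) (x : α) : ℕ :=
  (G.incidenceSet x).ncard

/-- Every vertex has degree `r`. -/
def IsRegular {α : Type u} {β : Type v} (G : Graph α β) (r : ℕ) : Prop :=
  ∀ x ∈ V(G), G.degree x = r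

/-- Walks in a multigraph, as alternating sequences of vertices and edges; vertices and edges may
be repeated. -/
inductive Walk {α : Type u} {β : Type v} (G : Graph α β) : α → α → Type (max u v)
  | nil {x : α} (hx : x ∈ V(G)) : Walk G x x
  | cons {x y z : α} (e : β) (h : G.IsLink e x y) (p : Walk G y z) : Walk G x z

namespace Walk

variable {α : Type u} {β : Type v} {G : Graph α β}

/-- The sequence of vertices of a walk, including both its first and its last vertex. -/
def support {x y : α} : G.Walk x y → List α
  | nil (x := x) _ => [x]
  | cons (x := x) _ _ p => x :: p.support

/-- The sequence of edges of a walk. -/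
def edges {x y : α} : G.Walk x y → List β
  | nil _ => []
  | cons e _ p => e :: p.edges

/-- A trail is a walk that uses no edge more than once. -/
def IsTrail {x y : α} (p : G.Walk x y) : Prop := p.edges.Nodup

/-- A walk is spanning if it contains every vertex of the graph. -/
def IsSpanning {x y : α} (p : G.Walk x y) : Prop := ∀ z ∈ V(G), z ∈ p.support

open Classical in
/-- The number of times a closed walk meets `z`. The coincidence of the last vertex with the first
one is not counted as an additional visit to the initial vertex; the trivial walk meets its only
vertex once. -/
noncomputable def visits {x : α} (p : G.Walk x x) (z : α) : ℕ :=
  if p.edges = [] then p.support.count z else p.support.tail.count z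

end Walk

/-- An `f`-walk: a spanning closed walk that meets each vertex `x` at most `f x` times. -/
def HasFWalk {α : Type u} {β : Type v} (G : Graph α β) (f : α → ℤ) : Prop :=
  ∃ (x : α) (p : G.Walk x x), p.IsSpanning ∧ ∀ z ∈ V(G), (p.visits z : ℤ) ≤ f z

/-- An `f`-trail: a spanning closed trail that meets each vertex `x` at most `f x` times. -/
def HasFTrail {α : Type u} {β : Type v} (G : Graph α β) (f : α → ℤ) : Prop :=
  ∃ (x : α) (p : G.Walk x x), p.IsTrail ∧ p.IsSpanning ∧ ∀ z ∈ V(G), (p.visits z : ℤ) ≤ f z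

/-- A graph is connected if it is nonnull and any two of its vertices are joined by a walk. -/
def Connected {α : Type u} {β : Type v} (G : Graph α β) : Prop :=
  V(G).Nonempty ∧ ∀ x ∈ V(G), ∀ y ∈ V(G), Nonempty (G.Walk x y)

/-- A graph is `k`-edge-connected if it stays connected after the removal of any set of fewer than
`k` edges. -/
def EdgeConnected {α : Type u} {β : Type v} (G : Graph α β) (k : ℕ) : Prop :=
  ∀ F : Finset β, (F : Set β) ⊆ E(G) → F.card < k → (G.deleteEdges (F : Set β)).Connected

/-- An `A`-factor of `G` is a spanning subgraph whose degrees all lie in `A`. -/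
def IsFactor {α : Type u} {β : Type v} (H G : Graph α β) (A : Set ℕ) : Prop :=
  H ≤s G ∧ ∀ x ∈ V(H), H.degree x ∈ A

end Graph

/-! Everything rests on one statement about an edge set `E` whose cuts all have at least `k ≥ 4`
edges. Such a set contains a connected edge set with even degrees, of size at most `h v` at `v`, as
soon as `2 d(v) + 4k ≤ k h(v) + 8`. An Euler trail of that set then meets `v` half as often as its
degree, so `h = 2f + 1` gives part 1, and the constant bound 5 gives degrees 2 and 4 in part 3.

The connected even set is found inside an edge set `H` that is sparse and tight on the whole vertex
set, that is, a union of two disjoint spanning trees. Adding to one tree a set of edges of the other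
that corrects the parities makes all degrees even (`Connects.exists_even`). The degree bound is
obtained by choosing `H` with least total excess over `h`. Local exchanges (`exchange`) produce a
set `R` of vertices whose degrees can be lowered, and if some vertex still exceeds `h`, then
counting edges along the maximal tight subsets of `R` contradicts the cut condition
(`exists_sparse_tight_degree_le`).

For part 2, parallel edges are added to `G` and a trail in the larger graph is read as a walk in
`G`. For `k = 1` every edge is doubled and the whole graph is Eulerian. For `k = 2` doubling every
edge makes all cuts at least 4. For `k = 3` a set `J` is doubled that makes all degrees even, hence
all cuts even and at least 4, while the degree of `J` stays below about a third of `d`. This `J`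
comes from Tutte's theorem applied to `gadget`. -/

set_option linter.unusedSectionVars false

/-! ### Sparse edge sets, tight vertex sets and exchanges. -/

namespace EdgeCount

variable {α : Type*} {β : Type*} [DecidableEq α] [DecidableEq β] (s t : β → α)

/-- The edges of `H` with both ends in `Y`; the ends of an edge `e` are `s e` and `t e`. -/
def inner (H : Finset β) (Y : Finset α) : Finset β := H.filter fun e => s e ∈ Y ∧ t e ∈ Y

/-- The edges of `H` with exactly one end in `X`. -/
def cut (H : Finset β) (X : Finset α) : Finset β := H.filter fun e => ¬(s e ∈ X ↔ t e ∈ X)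

/-- The edges of `H` incident with `v`. -/
def starEdges (H : Finset β) (v : α) : Finset β := H.filter fun e => s e = v ∨ t e = v

/-- Every nonempty vertex set `Y` spans at most `2|Y| - 2` edges of `H`. -/
def Sparse (H : Finset β) : Prop := ∀ Y : Finset α, Y.Nonempty → (inner s t H Y).card + 2 ≤ 2 * Y.card

/-- `Y` spans at least `2|Y| - 2` edges of `H`. -/
def Tight (H : Finset β) (Y : Finset α) : Prop := Y.Nonempty ∧ 2 * Y.card ≤ (inner s t H Y).card + 2

/-- The edge set `T` connects the vertex set `V`: it meets every cut of `V`. -/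
def Connects (T : Finset β) (V : Finset α) : Prop :=
  ∀ X ⊆ V, X.Nonempty → X ≠ V → (cut s t T X).Nonempty

/-- `H` and `H'` have the same edges, except for those with both ends in `Y`. -/
def AgreeOff (Y : Finset α) (H H' : Finset β) : Prop :=
  ∀ e, ¬(s e ∈ Y ∧ t e ∈ Y) → (e ∈ H ↔ e ∈ H')

variable {s t}

theorem mem_inner {H : Finset β} {Y : Finset α} {e : β} :
    e ∈ inner s t H Y ↔ e ∈ H ∧ s e ∈ Y ∧ t e ∈ Y := by simp [inner]

theorem mem_cut {H : Finset β} {Y : Finset α} {e : β} :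
    e ∈ cut s t H Y ↔ e ∈ H ∧ ¬(s e ∈ Y ↔ t e ∈ Y) := by simp [cut]

theorem mem_starEdges {H : Finset β} {v : α} {e : β} :
    e ∈ starEdges s t H v ↔ e ∈ H ∧ (s e = v ∨ t e = v) := by simp [starEdges]

theorem inner_mono {H H' : Finset β} {Y Y' : Finset α} (hH : H ⊆ H') (hY : Y ⊆ Y') :
    inner s t H Y ⊆ inner s t H' Y' := by
  intro e he
  rw [mem_inner] at he ⊢
  exact ⟨hH he.1, hY he.2.1, hY he.2.2⟩

theorem inner_supermodular (H : Finset β) (X Y : Finset α) :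
    (inner s t H X).card + (inner s t H Y).card ≤
      (inner s t H (X ∪ Y)).card + (inner s t H (X ∩ Y)).card := by
  rw [← Finset.card_union_add_card_inter]
  gcongr
  · exact Finset.union_subset (inner_mono subset_rfl Finset.subset_union_left)
      (inner_mono subset_rfl Finset.subset_union_right)
  · intro e he
    simp only [Finset.mem_inter, mem_inner] at he ⊢
    tauto

theorem Sparse.mono {H H' : Finset β} (h : Sparse s t H) (hs : H' ⊆ H) : Sparse s t H' := fun Y hY =>
  (Nat.add_le_add_right (Finset.card_le_card (inner_mono hs subset_rfl)) 2).trans (h Y hY)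

theorem tight_singleton (H : Finset β) (x : α) : Tight s t H {x} :=
  ⟨Finset.singleton_nonempty x, by simp⟩

theorem Tight.mono {H H' : Finset β} {Y : Finset α} (h : Tight s t H Y) (hs : H ⊆ H') :
    Tight s t H' Y :=
  ⟨h.1, h.2.trans (Nat.add_le_add_right (Finset.card_le_card (inner_mono hs subset_rfl)) 2)⟩

/-- Uncrossing: the span count is supermodular and `2|Y| - 2` is modular on meeting sets, so
sparsity of the intersection forces the union to attain its bound. -/
theorem Tight.union {H : Finset β} {X Y : Finset α} (hH : Sparse s t H) (hX : Tight s t H X)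
    (hY : Tight s t H Y) (hXY : (X ∩ Y).Nonempty) : Tight s t H (X ∪ Y) := by
  refine ⟨hX.1.mono Finset.subset_union_left, ?_⟩
  have h1 := inner_supermodular (s := s) (t := t) H X Y
  have h2 := hH _ hXY
  have h3 := Finset.card_union_add_card_inter X Y
  have := hX.2
  have := hY.2
  omega

theorem Tight.inter {H : Finset β} {X Y : Finset α} (hH : Sparse s t H) (hX : Tight s t H X)
    (hY : Tight s t H Y) (hXY : (X ∩ Y).Nonempty) : Tight s t H (X ∩ Y) := by
  refine ⟨hXY, ?_⟩
  have h1 := inner_supermodular (s := s) (t := t) H X Y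
  have h2 := hH _ (hX.1.mono (Finset.subset_union_left (s₂ := Y)))
  have h3 := Finset.card_union_add_card_inter X Y
  have := hX.2
  have := hY.2
  omega

/-- One new edge raises the count of `Y` by at most one, and only if both its ends lie in `Y`. A
bound broken by the insertion was therefore attained before. -/
theorem Sparse.tight_of_insert {H : Finset β} {e : β} (hH : Sparse s t H) {Y : Finset α}
    (hY : Y.Nonempty) (hlt : 2 * Y.card < (inner s t (insert e H) Y).card + 2) :
    Tight s t H Y ∧ s e ∈ Y ∧ t e ∈ Y := by
  have h1 := hH Y hY
  by_cases he : s e ∈ Y ∧ t e ∈ Y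
  · have : inner s t (insert e H) Y ⊆ insert e (inner s t H Y) := by
      intro f hf
      simp only [Finset.mem_insert, mem_inner] at hf ⊢
      tauto
    have h2 := (Finset.card_le_card this).trans (Finset.card_insert_le _ _)
    exact ⟨⟨hY, by omega⟩, he⟩
  · have : inner s t (insert e H) Y ⊆ inner s t H Y := by
      intro f hf
      simp only [Finset.mem_insert, mem_inner] at hf ⊢
      rcases hf with ⟨rfl | h, h'⟩
      · exact absurd h' he
      · exact ⟨h, h'⟩
    have h2 := Finset.card_le_card this
    omega

/-- Exchanging `f` for `e` keeps `H` sparse if `f` lies in every large tight set spanning `e`. -/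
theorem Sparse.swap {H : Finset β} {e f : β} {P Q : Finset α} (hH : Sparse s t H)
    (hP : Tight s t H P) (hQ : Tight s t H Q) (hsP : s e ∈ P) (htQ : t e ∈ Q) (hf : f ∈ H)
    (hfP : ¬(s f ∈ P ∧ t f ∈ P)) (hfQ : ¬(s f ∈ Q ∧ t f ∈ Q))
    (hall : ∀ Z, Tight s t H Z → P ⊆ Z → Q ⊆ Z → s f ∈ Z ∧ t f ∈ Z) :
    Sparse s t (insert e (H.erase f)) := by
  intro Z hZ
  by_contra hlt
  have hH' : Sparse s t (H.erase f) := hH.mono (Finset.erase_subset _ _)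
  obtain ⟨hZt, hsZ, htZ⟩ := hH'.tight_of_insert (e := e) hZ (by omega)
  have erase_tight : ∀ {Y : Finset α}, Tight s t H Y → ¬(s f ∈ Y ∧ t f ∈ Y) →
      Tight s t (H.erase f) Y := by
    intro Y hY hfY
    have : inner s t (H.erase f) Y = inner s t H Y := by
      ext g
      simp only [mem_inner, Finset.mem_erase]
      constructor
      · tauto
      · rintro ⟨h1, h2⟩
        exact ⟨⟨fun h => hfY (h ▸ h2), h1⟩, h2⟩
    exact ⟨hY.1, by rw [this]; exact hY.2⟩
  -- A set `Z` violating sparsity meets `P` in `s e` and `Q` in `t e`, so `Z ∪ P ∪ Q` is tight even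
  -- without `f`. It spans `f` by `hall`, so with `f` restored it spans one edge too many.
  have h1 := hZt.union hH' (erase_tight hP hfP) ⟨s e, Finset.mem_inter.2 ⟨hsZ, hsP⟩⟩
  have h2 := h1.union hH' (erase_tight hQ hfQ)
    ⟨t e, Finset.mem_inter.2 ⟨Finset.mem_union_left _ htZ, htQ⟩⟩
  set W := Z ∪ P ∪ Q
  have hfW := hall W (h2.mono (Finset.erase_subset _ _))
    (fun x hx => by simp [W, hx]) (fun x hx => by simp [W, hx])
  have h3 : inner s t (H.erase f) W ⊂ inner s t H W := by
    refine (Finset.ssubset_iff_of_subset (inner_mono (Finset.erase_subset _ _) subset_rfl)).2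
      ⟨f, mem_inner.2 ⟨hf, hfW⟩, by simp [mem_inner]⟩
  have h4 := Finset.card_lt_card h3
  have h5 := hH W h2.1
  have h6 := h2.2
  omega

theorem AgreeOff.symm {Y : Finset α} {H H' : Finset β} (h : AgreeOff s t Y H H') :
    AgreeOff s t Y H' H := fun e he => (h e he).symm

theorem AgreeOff.inner_card_le {Y Z : Finset α} {H H' : Finset β} (h : AgreeOff s t Y H H')
    (hYZ : Y ⊆ Z) (hH : (inner s t H Y).card ≤ (inner s t H' Y).card) :
    (inner s t H Z).card ≤ (inner s t H' Z).card := by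
  have split : ∀ K : Finset β, (inner s t K Z).card =
      (inner s t K Y).card + ((inner s t K Z).filter fun e => ¬(s e ∈ Y ∧ t e ∈ Y)).card := by
    intro K
    rw [← Finset.card_filter_add_card_filter_not (s := inner s t K Z) (fun e => s e ∈ Y ∧ t e ∈ Y)]
    congr 2
    ext e
    simp only [Finset.mem_filter, mem_inner]
    constructor
    · rintro ⟨h1, h2⟩
      exact ⟨h1.1, h2⟩
    · rintro ⟨h1, h2⟩
      exact ⟨⟨h1, hYZ h2.1, hYZ h2.2⟩, h2⟩
  have hrest : ((inner s t H Z).filter fun e => ¬(s e ∈ Y ∧ t e ∈ Y)) =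
      (inner s t H' Z).filter fun e => ¬(s e ∈ Y ∧ t e ∈ Y) := by
    ext e
    simp only [Finset.mem_filter, mem_inner]
    constructor
    · rintro ⟨h1, h2⟩
      exact ⟨⟨(h e h2).1 h1.1, h1.2⟩, h2⟩
    · rintro ⟨h1, h2⟩
      exact ⟨⟨(h e h2).2 h1.1, h1.2⟩, h2⟩
  rw [split H, split H', hrest]
  omega

/-- Inside `Y` the set `H'` has at least as many edges as the sparse set `H` can have, and elsewhere
the two agree. -/
theorem AgreeOff.tight {Y Z : Finset α} {H H' : Finset β} (h : AgreeOff s t Y H H')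
    (hYZ : Y ⊆ Z) (hH : Sparse s t H) (hY : Tight s t H' Y) (hZ : Tight s t H Z) :
    Tight s t H' Z := by
  have h1 := hH Y hY.1
  have h2 := hY.2
  have h3 := h.inner_card_le hYZ (by omega)
  exact ⟨hZ.1, by have := hZ.2; omega⟩

theorem AgreeOff.star_eq {Y : Finset α} {H H' : Finset β} (h : AgreeOff s t Y H H') {x : α}
    (hx : x ∉ Y) : starEdges s t H x = starEdges s t H' x := by
  ext e
  simp only [mem_starEdges]
  constructor <;> rintro ⟨h1, h2⟩ <;> refine ⟨?_, h2⟩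
  · exact (h e (by rintro ⟨h3, h4⟩; rcases h2 with rfl | rfl <;> contradiction)).1 h1
  · exact (h e (by rintro ⟨h3, h4⟩; rcases h2 with rfl | rfl <;> contradiction)).2 h1

/-- Replacing the edges inside a tight set by another sparse set keeps `H` sparse. -/
theorem Sparse.replace {Y : Finset α} {H N : Finset β} (hH : Sparse s t H) (hY : Tight s t H Y)
    (hN : Sparse s t N) (hNY : Tight s t N Y) :
    Sparse s t (H.filter (fun e => ¬(s e ∈ Y ∧ t e ∈ Y)) ∪ inner s t N Y) ∧
    AgreeOff s t Y H (H.filter (fun e => ¬(s e ∈ Y ∧ t e ∈ Y)) ∪ inner s t N Y) ∧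
    Tight s t (H.filter (fun e => ¬(s e ∈ Y ∧ t e ∈ Y)) ∪ inner s t N Y) Y := by
  set K := H.filter (fun e => ¬(s e ∈ Y ∧ t e ∈ Y)) ∪ inner s t N Y with hK
  have hagree : AgreeOff s t Y H K := by
    intro e he
    simp only [hK, Finset.mem_union, Finset.mem_filter, mem_inner]
    tauto
  have hKin : ∀ Z ⊆ Y, inner s t K Z = inner s t N Z := by
    intro Z hZ
    ext e
    simp only [hK, Finset.mem_union, Finset.mem_filter, mem_inner]
    have h1 := @hZ (s e)
    have h2 := @hZ (t e)
    tauto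
  have hYK : Tight s t K Y := ⟨hNY.1, by rw [hKin Y subset_rfl]; exact hNY.2⟩
  refine ⟨?_, hagree, hYK⟩
  intro Z hZ
  have hin := hKin (Z ∩ Y) Finset.inter_subset_right
  have h0 := inner_supermodular (s := s) (t := t) K Z Y
  have h3 := Finset.card_union_add_card_inter Z Y
  rcases (Z ∩ Y).eq_empty_or_nonempty with he | hne
  · have : inner s t K Z ⊆ inner s t H Z := by
      intro e
      simp only [mem_inner]
      rintro ⟨h1, h2⟩
      refine ⟨(hagree e fun h => ?_).2 h1, h2⟩
      have : s e ∈ Z ∩ Y := Finset.mem_inter.2 ⟨h2.1, h.1⟩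
      simp [he] at this
    have := Finset.card_le_card this
    have := hH Z hZ
    omega
  -- Supermodularity bounds the count of `Z` through `Z ∩ Y`, where `K` agrees with the sparse set
  -- `N`, and `Z ∪ Y`, where `K` has no more edges than `H`.
  · have h1 := hN _ hne
    rw [← hin] at h1
    have h4 := hagree.symm.inner_card_le (Z := Z ∪ Y) Finset.subset_union_right (by
      have := hN Y hY.1
      rw [← hKin Y subset_rfl] at this
      have := hY.2
      omega)
    have h5 := hH (Z ∪ Y) (hZ.mono Finset.subset_union_left)
    have := hYK.2
    omega

/-- There is a least tight set spanning the ends of `e`. -/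
theorem Sparse.exists_least_tight {H : Finset β} {V : Finset α} (hH : Sparse s t H)
    (hV : Tight s t H V) {e : β} (hs : s e ∈ V) (ht : t e ∈ V) :
    ∃ Y ⊆ V, Tight s t H Y ∧ s e ∈ Y ∧ t e ∈ Y ∧
      ∀ Z, Tight s t H Z → s e ∈ Z → t e ∈ Z → Y ⊆ Z := by
  classical
  let F := V.powerset.filter fun Y => Tight s t H Y ∧ s e ∈ Y ∧ t e ∈ Y
  have hF : F.Nonempty := ⟨V, by simp [F, hV, hs, ht]⟩
  obtain ⟨Y, hYF, hmin⟩ := F.exists_min_image Finset.card hF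
  simp only [F, Finset.mem_filter, Finset.mem_powerset] at hYF hmin
  refine ⟨Y, hYF.1, hYF.2.1, hYF.2.2.1, hYF.2.2.2, fun Z hZ hsZ htZ => ?_⟩
  have h1 : s e ∈ Y ∩ Z := Finset.mem_inter.2 ⟨hYF.2.2.1, hsZ⟩
  have h2 := hmin (Y ∩ Z) ⟨Finset.inter_subset_left.trans hYF.1,
    hYF.2.1.inter hH hZ ⟨_, h1⟩, h1, Finset.mem_inter.2 ⟨hYF.2.2.2, htZ⟩⟩
  have := Finset.eq_of_subset_of_card_le Finset.inter_subset_left h2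
  exact Finset.inter_eq_left.1 this

/-- A vertex of a tight set with another vertex has an edge inside this set. -/
theorem Tight.exists_edge {H : Finset β} {Y : Finset α} (hH : Sparse s t H) (hY : Tight s t H Y)
    {x y : α} (hx : x ∈ Y) (hy : y ∈ Y) (hxy : x ≠ y) :
    ∃ f ∈ inner s t H Y, s f = x ∨ t f = x := by
  by_contra! hcon
  have h1 : inner s t H Y ⊆ inner s t H (Y.erase x) := by
    intro f hf
    have := hcon f hf
    simp only [mem_inner, Finset.mem_erase] at hf ⊢
    tauto
  have h2 := Finset.card_le_card h1
  have h3 := hH (Y.erase x) ⟨y, by simp [hy, hxy.symm]⟩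
  have h4 := Finset.card_erase_of_mem hx
  have h5 := Finset.card_pos.2 ⟨x, hx⟩
  have := hY.2
  omega

end EdgeCount

/-! ### Counting along maximal tight sets, and the degree bound. -/

namespace EdgeCount

variable {α : Type*} {β : Type*} [DecidableEq α] [DecidableEq β] {s t : β → α}

theorem degree_sum {H : Finset β} (hloop : ∀ e ∈ H, s e ≠ t e) (S : Finset α) :
    ∑ v ∈ S, (starEdges s t H v).card = (cut s t H S).card + 2 * (inner s t H S).card := by
  have h1 : ∑ v ∈ S, (starEdges s t H v).card = ∑ e ∈ H, (S.filter fun v => s e = v ∨ t e = v).card := by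
    simp only [starEdges]
    exact Finset.sum_card_bipartiteAbove_eq_sum_card_bipartiteBelow (fun v e => s e = v ∨ t e = v)
  rw [h1, cut, inner, Finset.card_filter, Finset.card_filter, Finset.mul_sum, ← Finset.sum_add_distrib]
  refine Finset.sum_congr rfl fun e he => ?_
  have hne := hloop e he
  have h2 : (S.filter fun v => s e = v ∨ t e = v) =
      (if s e ∈ S then {s e} else ∅) ∪ (if t e ∈ S then {t e} else ∅) := by
    ext v
    by_cases h1 : s e ∈ S <;> by_cases h2 : t e ∈ S <;> simp [h1, h2] <;> grind
  rw [h2]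
  by_cases h1 : s e ∈ S <;> by_cases h2 : t e ∈ S <;> simp [h1, h2, hne]

theorem card_split {H : Finset β} {V S : Finset α} (hV : ∀ e ∈ H, s e ∈ V ∧ t e ∈ V) :
    H.card = (inner s t H S).card + (cut s t H S).card + (inner s t H (V \ S)).card := by
  rw [inner, cut, inner, Finset.card_filter, Finset.card_filter, Finset.card_filter,
    ← Finset.sum_add_distrib, ← Finset.sum_add_distrib, Finset.card_eq_sum_ones]
  refine Finset.sum_congr rfl fun e he => ?_
  have := hV e he
  by_cases h1 : s e ∈ S <;> by_cases h2 : t e ∈ S <;> simp [h1, h2, this]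

theorem cut_sdiff {H : Finset β} {V S : Finset α} (hV : ∀ e ∈ H, s e ∈ V ∧ t e ∈ V) :
    cut s t H (V \ S) = cut s t H S := by
  ext e
  simp only [mem_cut, Finset.mem_sdiff]
  refine and_congr_right fun he => ?_
  have := hV e he
  tauto

/-- Counting edges along the maximal tight subsets of `R`. -/
theorem Sparse.count_parts {E H : Finset β} {R V : Finset α} {k : ℕ} (hH : Sparse s t H)
    (hHE : H ⊆ E) (hRV : R ⊆ V)
    (hcut : ∀ X ⊆ V, X.Nonempty → X ≠ V → k ≤ (cut s t E X).card)
    (hcl : ∀ e ∈ E, e ∉ H → s e ∈ R → t e ∈ R → ∃ Z ⊆ R, Tight s t H Z ∧ s e ∈ Z ∧ t e ∈ Z)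
    (hnt : ¬(R = V ∧ Tight s t H V)) :
    ∃ p x : ℕ, (inner s t H R).card + 2 * p = 2 * R.card + x ∧ k * p ≤ 2 * x + (cut s t E R).card := by
  classical
  -- Tight sets through `y` are closed under union, so there is a largest one `c y` inside `R`.
  -- These largest sets partition `R`.
  have hmax : ∀ y ∈ R, ∃ C ⊆ R, Tight s t H C ∧ y ∈ C ∧
      ∀ Z ⊆ R, Tight s t H Z → y ∈ Z → Z ⊆ C := by
    intro y hy
    let F := R.powerset.filter fun Y => Tight s t H Y ∧ y ∈ Y
    have hF : F.Nonempty := ⟨{y}, by simp [F, hy, tight_singleton]⟩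
    obtain ⟨C, hC, hCmax⟩ := F.exists_max_image Finset.card hF
    simp only [F, Finset.mem_filter, Finset.mem_powerset] at hC hCmax
    refine ⟨C, hC.1, hC.2.1, hC.2.2, fun Z hZ hZt hyZ => ?_⟩
    have h1 := hCmax (C ∪ Z) ⟨Finset.union_subset hC.1 hZ,
      hC.2.1.union hH hZt ⟨y, Finset.mem_inter.2 ⟨hC.2.2, hyZ⟩⟩, Finset.mem_union_left _ hC.2.2⟩
    have := Finset.eq_of_subset_of_card_le (Finset.subset_union_left (s₁ := C) (s₂ := Z)) h1
    rw [this]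
    exact Finset.subset_union_right
  choose! c hcR hct hcmem hcmax using hmax
  have hceq : ∀ y ∈ R, ∀ z ∈ c y, c z = c y := by
    intro y hy z hz
    have hzR := hcR y hy hz
    have h1 := hcmax z hzR (c y) (hcR y hy) (hct y hy) hz
    exact (hcmax y hy (c z) (hcR z hzR) (hct z hzR) (h1 (hcmem y hy))).antisymm h1
  have hmemP : ∀ C ∈ R.image c, ∀ z, z ∈ C ↔ z ∈ R ∧ c z = C := by
    intro C hC z
    obtain ⟨y, hy, rfl⟩ := Finset.mem_image.1 hC
    exact ⟨fun hz => ⟨hcR y hy hz, hceq y hy z hz⟩, fun ⟨hz, he⟩ => he ▸ hcmem z hz⟩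
  set P := R.image c with hP
  set X := (inner s t E R).filter fun e => c (s e) ≠ c (t e) with hX
  -- By `hcl` an edge of `E` outside `H` with both ends in `R` stays within one part, so the edges
  -- between parts all belong to `H`.
  have hXH : X = (inner s t H R).filter fun e => c (s e) ≠ c (t e) := by
    ext e
    simp only [hX, Finset.mem_filter, mem_inner]
    refine ⟨fun ⟨⟨h1, h2⟩, h3⟩ => ⟨⟨?_, h2⟩, h3⟩, fun ⟨⟨h1, h2⟩, h3⟩ => ⟨⟨hHE h1, h2⟩, h3⟩⟩
    by_contra heH
    obtain ⟨Z, hZR, hZ, hsZ, htZ⟩ := hcl e h1 heH h2.1 h2.2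
    exact h3 (hceq (s e) h2.1 (t e) (hcmax _ h2.1 Z hZR hZ hsZ htZ)).symm
  have hcardR : R.card = ∑ C ∈ P, C.card := by
    rw [Finset.card_eq_sum_card_fiberwise (f := c) (t := P)
      (fun y hy => Finset.mem_image_of_mem c hy)]
    refine Finset.sum_congr rfl fun C hC => ?_
    congr 1
    ext z
    rw [hmemP C hC z, Finset.mem_filter]
  have hcardI : ((inner s t H R).filter fun e => c (s e) = c (t e)).card =
      ∑ C ∈ P, (inner s t H C).card := by
    rw [Finset.card_eq_sum_card_fiberwise (f := fun e => c (s e)) (t := P)]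
    · refine Finset.sum_congr rfl fun C hC => ?_
      congr 1
      ext e
      simp only [Finset.mem_filter, mem_inner, hmemP C hC]
      grind
    · intro e he
      simp only [Finset.coe_filter, Set.mem_ofPred_eq, mem_inner] at he
      exact Finset.mem_image_of_mem c he.1.2.1
  have htightC : ∀ C ∈ P, (inner s t H C).card + 2 = 2 * C.card := by
    intro C hC
    obtain ⟨y, hy, rfl⟩ := Finset.mem_image.1 hC
    exact (hH _ (hct y hy).1).antisymm (hct y hy).2
  refine ⟨P.card, X.card, ?_, ?_⟩
  · have h1 := Finset.card_filter_add_card_filter_not (s := inner s t H R)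
      (fun e => c (s e) = c (t e))
    have h2 : ∑ C ∈ P, ((inner s t H C).card + 2) = ∑ C ∈ P, 2 * C.card :=
      Finset.sum_congr rfl htightC
    rw [Finset.sum_add_distrib, ← Finset.mul_sum, Finset.sum_const, smul_eq_mul] at h2
    have h3 : X.card = ((inner s t H R).filter fun e => ¬ c (s e) = c (t e)).card := by rw [hXH]
    omega
  -- The `k` or more edges leaving each part are counted twice if they join two parts and once if
  -- they leave `R`. No part is all of `V`, by `hnt`.
  · have hk : ∀ C ∈ P, k ≤ (cut s t E C).card := by
      intro C hC
      obtain ⟨y, hy, rfl⟩ := Finset.mem_image.1 hC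
      refine hcut _ ((hcR y hy).trans hRV) (hct y hy).1 fun hCV => hnt ⟨?_, hCV ▸ hct y hy⟩
      exact hRV.antisymm (hCV ▸ hcR y hy)
    have h1 : k * P.card ≤ ∑ C ∈ P, (cut s t E C).card := by
      rw [mul_comm, ← smul_eq_mul, ← Finset.sum_const]
      exact Finset.sum_le_sum hk
    have h2 : ∑ C ∈ P, (cut s t E C).card =
        ∑ e ∈ E, (P.filter fun C => ¬(s e ∈ C ↔ t e ∈ C)).card := by
      simp only [cut]
      exact Finset.sum_card_bipartiteAbove_eq_sum_card_bipartiteBelow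
        (fun C e => ¬(s e ∈ C ↔ t e ∈ C))
    have h3 : 2 * X.card + (cut s t E R).card =
        ∑ e ∈ E, (2 * (if (s e ∈ R ∧ t e ∈ R) ∧ c (s e) ≠ c (t e) then 1 else 0) +
          if ¬(s e ∈ R ↔ t e ∈ R) then 1 else 0) := by
      rw [hX, inner, Finset.filter_filter, cut, Finset.card_filter, Finset.card_filter,
        Finset.mul_sum, ← Finset.sum_add_distrib]
    rw [h3]
    refine (h1.trans_eq h2).trans (Finset.sum_le_sum fun e _ => ?_)
    have hsub : (P.filter fun C => ¬(s e ∈ C ↔ t e ∈ C)) ⊆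
        (if s e ∈ R then {c (s e)} else ∅) ∪ (if t e ∈ R then {c (t e)} else ∅) := by
      intro C hC
      rw [Finset.mem_filter] at hC
      rw [hmemP C hC.1, hmemP C hC.1] at hC
      by_cases h1 : s e ∈ R <;> by_cases h2 : t e ∈ R <;> simp [h1, h2] <;> grind
    by_cases hs : s e ∈ R <;> by_cases ht : t e ∈ R
    · by_cases hc : c (s e) = c (t e)
      · have : (P.filter fun C => ¬(s e ∈ C ↔ t e ∈ C)) = ∅ := by
          refine Finset.filter_eq_empty_iff.2 fun C hC => ?_
          rw [hmemP C hC, hmemP C hC, hc]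
          simp [hs, ht]
        rw [this]
        simp
      · refine (Finset.card_le_card hsub).trans ((Finset.card_union_le _ _).trans ?_)
        simp [hs, ht, hc]
    all_goals
      refine (Finset.card_le_card hsub).trans ((Finset.card_union_le _ _).trans ?_)
      simp [hs, ht]

/-- A maximal sparse `H ⊆ E` works. Otherwise `count_parts` with `R = V` gives `4p ≤ 2x`, so `H` has
at least `2|V|` edges, more than it would if `V` were not tight. -/
theorem exists_sparse_tight {E : Finset β} {V : Finset α} {k : ℕ} (hk : 4 ≤ k) (hne : V.Nonempty)
    (hE : ∀ e ∈ E, s e ∈ V ∧ t e ∈ V)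
    (hcut : ∀ X ⊆ V, X.Nonempty → X ≠ V → k ≤ (cut s t E X).card) :
    ∃ H ⊆ E, Sparse s t H ∧ Tight s t H V := by
  classical
  let F := E.powerset.filter fun H => Sparse s t H
  have hF : F.Nonempty := ⟨∅, by
    simp only [F, Finset.mem_filter, Finset.empty_mem_powerset, true_and]
    intro Y hY
    have := Finset.card_pos.2 hY
    simp only [inner, Finset.filter_empty, Finset.card_empty]
    omega⟩
  obtain ⟨H, hHF, hmax⟩ := F.exists_max_image Finset.card hF
  simp only [F, Finset.mem_filter, Finset.mem_powerset] at hHF hmax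
  refine ⟨H, hHF.1, hHF.2, ?_⟩
  by_contra hnt
  obtain ⟨p, x, h1, h2⟩ := hHF.2.count_parts (V := V) hHF.1 subset_rfl hcut (by
    intro e he heH hs ht
    have h3 : ¬ Sparse s t (insert e H) := by
      intro hsp
      have := hmax _ ⟨Finset.insert_subset he hHF.1, hsp⟩
      rw [Finset.card_insert_of_notMem heH] at this
      omega
    simp only [Sparse, not_forall, not_le] at h3
    obtain ⟨Y, hY, hlt⟩ := h3
    obtain ⟨hYt, hsY, htY⟩ := hHF.2.tight_of_insert hY hlt
    have hYV : (Y ∩ V).Nonempty := ⟨s e, Finset.mem_inter.2 ⟨hsY, hs⟩⟩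
    refine ⟨Y ∩ V, Finset.inter_subset_right, ⟨hYV, ?_⟩, Finset.mem_inter.2 ⟨hsY, hs⟩,
      Finset.mem_inter.2 ⟨htY, ht⟩⟩
    have h4 : inner s t H Y ⊆ inner s t H (Y ∩ V) := by
      intro f hf
      have := hE f
      have h4 : f ∈ H → f ∈ E := fun h' => hHF.1 h'
      simp only [mem_inner, Finset.mem_inter] at hf ⊢
      tauto
    have h5 := Finset.card_le_card h4
    have h6 := Finset.card_le_card (Finset.inter_subset_left (s₁ := Y) (s₂ := V))
    have h7 := hYt.2
    omega) (fun h => hnt h.2)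
  have h3 : cut s t E V = ∅ := by
    refine Finset.filter_eq_empty_iff.2 fun e he => ?_
    simp [hE e he]
  have h4 : ¬ 2 * V.card ≤ (inner s t H V).card + 2 := fun h => hnt ⟨hne, h⟩
  rw [h3, Finset.card_empty] at h2
  have h5 : 4 * p ≤ k * p := Nat.mul_le_mul_right p hk
  omega

/-- Relaxations of two disjoint tight sets can be carried out together. -/
theorem combine {H HP HQ : Finset β} {P Q : Finset α} (hH : Sparse s t H)
    (hP : Tight s t H P) (hQ : Tight s t H Q) (hPQ : Disjoint P Q)
    (hHP : Sparse s t HP) (aP : AgreeOff s t P H HP) (tP : Tight s t HP P)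
    (hHQ : Sparse s t HQ) (aQ : AgreeOff s t Q H HQ) (tQ : Tight s t HQ Q) :
    ∃ K ⊆ HP ∪ HQ, Sparse s t K ∧ Tight s t K P ∧ Tight s t K Q ∧
      (∀ Z, P ⊆ Z → Q ⊆ Z → (Tight s t H Z ↔ Tight s t K Z)) ∧
      (∀ e, ¬(s e ∈ P ∧ t e ∈ P) → ¬(s e ∈ Q ∧ t e ∈ Q) → (e ∈ H ↔ e ∈ K)) ∧
      (∀ v ∈ P, starEdges s t K v = starEdges s t HP v) ∧ ∀ v ∈ Q, starEdges s t K v = starEdges s t HQ v := by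
  have hd : ∀ {v}, v ∈ P → v ∉ Q := fun h1 h2 => Finset.disjoint_left.1 hPQ h1 h2
  have tQ' : Tight s t HP Q := by
    refine ⟨hQ.1, ?_⟩
    have : inner s t HP Q = inner s t H Q := by
      ext e
      simp only [mem_inner]
      refine and_congr_left fun h => (aP e fun h' => hd h'.1 h.1).symm
    rw [this]
    exact hQ.2
  -- The relaxation `HP` leaves the edges inside `Q` untouched, as `P` and `Q` are disjoint, so `Q`
  -- is still tight there and its inside can be replaced next.
  obtain ⟨hK, aK, tK⟩ := hHP.replace tQ' hHQ tQ
  set K := HP.filter (fun e => ¬(s e ∈ Q ∧ t e ∈ Q)) ∪ inner s t HQ Q with hKdef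
  have tKP : Tight s t K P := by
    refine ⟨tP.1, ?_⟩
    have : inner s t K P = inner s t HP P := by
      ext e
      simp only [mem_inner]
      refine and_congr_left fun h => (aK e fun h' => hd h.1 h'.1).symm
    rw [this]
    exact tP.2
  refine ⟨K, ?_, hK, tKP, tK, ?_, ?_, ?_, ?_⟩
  · exact Finset.union_subset_union (Finset.filter_subset _ _) (Finset.filter_subset _ _)
  · intro Z hPZ hQZ
    constructor
    · intro h
      exact aK.tight hQZ hHP tK (aP.tight hPZ hH tP h)
    · intro h
      exact aP.symm.tight hPZ hHP hP (aK.symm.tight hQZ hK tQ' h)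
  · intro e h1 h2
    exact (aP e h1).trans (aK e h2)
  · intro v hv
    exact (aK.star_eq (hd hv)).symm
  · intro v hv
    ext e
    simp only [mem_starEdges]
    refine and_congr_left fun h => ?_
    by_cases hin : s e ∈ Q ∧ t e ∈ Q
    · simp [hKdef, hin, mem_inner]
    · have hvP : v ∉ P := fun h' => hd h' hv
      rw [← aK e hin, ← aP e (by rintro ⟨h3, h4⟩; rcases h with rfl | rfl <;> contradiction), aQ e hin]

/-- `x` can be given degree less than `h x` by changing `H` inside the tight set `Y` only. -/
def Relaxable (s t : β → α) (E H : Finset β) (h : α → ℕ) (x : α) (Y : Finset α) : Prop :=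
  Tight s t H Y ∧ x ∈ Y ∧ ∃ H' ⊆ E, Sparse s t H' ∧ AgreeOff s t Y H H' ∧ Tight s t H' Y ∧
    (starEdges s t H' x).card < h x ∧ ∀ v ∈ Y, (starEdges s t H' v).card ≤ h v

/-- Relaxing both ends of a missing edge `e` leaves room for it there; then `e` is added and an edge
`f` at `x` inside `Y` is dropped, which lowers the degree of `x`. Since `Y` is the least tight set
spanning `e`, the edge `f` lies in every tight set containing `P` and `Q`, as `Sparse.swap` needs.
-/
theorem exchange {E H : Finset β} {P Q Y : Finset α} {h : α → ℕ} {e : β} {x : α}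
    (hH : Sparse s t H) (heE : e ∈ E) (heH : e ∉ H)
    (rP : Relaxable s t E H h (s e) P) (rQ : Relaxable s t E H h (t e) Q)
    (hPQ : Disjoint P Q) (hY : Tight s t H Y) (hsY : s e ∈ Y) (htY : t e ∈ Y)
    (hleast : ∀ Z, Tight s t H Z → s e ∈ Z → t e ∈ Z → Y ⊆ Z)
    (hx : x ∈ Y) (hxP : x ∉ P) (hxQ : x ∉ Q) :
    Tight s t H (Y ∪ P ∪ Q) ∧ ∃ H' ⊆ E, Sparse s t H' ∧ AgreeOff s t (Y ∪ P ∪ Q) H H' ∧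
      Tight s t H' (Y ∪ P ∪ Q) ∧ (starEdges s t H' x).card < (starEdges s t H x).card ∧
      (∀ v ∈ P ∪ Q, (starEdges s t H' v).card ≤ h v) ∧
      ∀ v, v ∉ P ∪ Q → (starEdges s t H' v).card ≤ (starEdges s t H v).card := by
  obtain ⟨hP, hsP, HP, hPE, spP, aP, tP, lP, dP⟩ := rP
  obtain ⟨hQ, htQ, HQ, hQE, spQ, aQ, tQ, lQ, dQ⟩ := rQ
  obtain ⟨K, hKsub, hK, tKP, tKQ, hKt, hKa, hKP, hKQ⟩ :=
    combine hH hP hQ hPQ spP aP tP spQ aQ tQ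
  have hd : ∀ {v}, v ∈ P → v ∉ Q := fun h1 h2 => Finset.disjoint_left.1 hPQ h1 h2
  obtain ⟨f, hf, hfx⟩ := hY.exists_edge hH hx hsY (fun h' => hxP (h' ▸ hsP))
  rw [mem_inner] at hf
  have hfP : ¬(s f ∈ P ∧ t f ∈ P) := by rintro ⟨h1, h2⟩; rcases hfx with rfl | rfl <;> contradiction
  have hfQ : ¬(s f ∈ Q ∧ t f ∈ Q) := by rintro ⟨h1, h2⟩; rcases hfx with rfl | rfl <;> contradiction
  have hfK : f ∈ K := (hKa f hfP hfQ).1 hf.1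
  have heP : ¬(s e ∈ P ∧ t e ∈ P) := fun h' => hd h'.2 htQ
  have heQ : ¬(s e ∈ Q ∧ t e ∈ Q) := fun h' => hd hsP h'.1
  have heK : e ∉ K := fun h' => heH ((hKa e heP heQ).2 h')
  have hst : s e ≠ t e := fun h' => hd hsP (h' ▸ htQ)
  set W := Y ∪ P ∪ Q with hW
  have hYW : Y ⊆ W := fun v hv => by simp [hW, hv]
  have hPW : P ⊆ W := fun v hv => by simp [hW, hv]
  have hQW : Q ⊆ W := fun v hv => by simp [hW, hv]
  have hWt : Tight s t H W :=
    (hY.union hH hP ⟨s e, Finset.mem_inter.2 ⟨hsY, hsP⟩⟩).union hH hQ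
      ⟨t e, Finset.mem_inter.2 ⟨Finset.mem_union_left _ htY, htQ⟩⟩
  have hWK := (hKt W hPW hQW).1 hWt
  have hsp : Sparse s t (insert e (K.erase f)) :=
    hK.swap tKP tKQ hsP htQ hfK hfP hfQ fun Z hZ hPZ hQZ => by
      have := hleast Z ((hKt Z hPZ hQZ).2 hZ) (hPZ hsP) (hQZ htQ)
      exact ⟨this hf.2.1, this hf.2.2⟩
  have hstar : ∀ v, v ≠ s e → v ≠ t e →
      starEdges s t (insert e (K.erase f)) v = (starEdges s t K v).erase f := by
    intro v h1 h2
    ext g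
    simp only [mem_starEdges, Finset.mem_insert, Finset.mem_erase]
    constructor
    · rintro ⟨rfl | h3, h4⟩
      · rcases h4 with h4 | h4 <;> exact absurd h4.symm (by assumption)
      · exact ⟨h3.1, h3.2, h4⟩
    · rintro ⟨h3, h4, h5⟩
      exact ⟨Or.inr ⟨h3, h4⟩, h5⟩
  have hstar' : ∀ v, (starEdges s t (insert e (K.erase f)) v).card ≤ (starEdges s t K v).card + 1 := by
    intro v
    refine (Finset.card_le_card (t := insert e (starEdges s t K v)) ?_).trans (Finset.card_insert_le _ _)
    intro g
    simp only [mem_starEdges, Finset.mem_insert, Finset.mem_erase]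
    rintro ⟨h1 | h1, h2⟩
    · exact Or.inl h1
    · exact Or.inr ⟨h1.2, h2⟩
  have hout : ∀ v, v ∉ P → v ∉ Q → starEdges s t K v = starEdges s t H v := by
    intro v h1 h2
    ext g
    simp only [mem_starEdges]
    refine and_congr_left fun h' => (hKa g ?_ ?_).symm
    · rintro ⟨h3, h4⟩; rcases h' with rfl | rfl <;> contradiction
    · rintro ⟨h3, h4⟩; rcases h' with rfl | rfl <;> contradiction
  refine ⟨hWt, insert e (K.erase f), ?_, hsp, ?_, ?_, ?_, ?_, ?_⟩
  · exact Finset.insert_subset heE ((Finset.erase_subset _ _).trans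
      (hKsub.trans (Finset.union_subset hPE hQE)))
  · intro g hg
    have h1 : g ≠ e := by rintro rfl; exact hg ⟨hPW hsP, hQW htQ⟩
    have h2 : g ≠ f := by rintro rfl; exact hg ⟨hYW hf.2.1, hYW hf.2.2⟩
    have h3 := hKa g (fun h' => hg ⟨hPW h'.1, hPW h'.2⟩) (fun h' => hg ⟨hQW h'.1, hQW h'.2⟩)
    simp [h1, h2, h3]
  · refine ⟨hWt.1, ?_⟩
    have h1 : inner s t (insert e (K.erase f)) W = insert e ((inner s t K W).erase f) := by
      ext g
      simp only [mem_inner, Finset.mem_insert, Finset.mem_erase]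
      constructor
      · rintro ⟨h1 | h1, h2⟩
        · exact Or.inl h1
        · exact Or.inr ⟨h1.1, h1.2, h2⟩
      · rintro (rfl | h')
        · exact ⟨Or.inl rfl, hPW hsP, hQW htQ⟩
        · exact ⟨Or.inr ⟨h'.1, h'.2.1⟩, h'.2.2⟩
    have h2 : f ∈ inner s t K W := mem_inner.2 ⟨hfK, hYW hf.2.1, hYW hf.2.2⟩
    rw [h1, Finset.card_insert_of_notMem (by simp [mem_inner, heK]), Finset.card_erase_of_mem h2]
    have := Finset.card_pos.2 ⟨f, h2⟩
    have := hWK.2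
    omega
  · have h1 : f ∈ starEdges s t K x := mem_starEdges.2 ⟨hfK, hfx⟩
    rw [hstar x (fun h' => hxP (h' ▸ hsP)) (fun h' => hxQ (h' ▸ htQ)), ← hout x hxP hxQ]
    exact Finset.card_erase_lt_of_mem h1
  · intro v hv
    by_cases h1 : v = s e
    · subst h1
      have := hstar' (s e)
      rw [hKP _ hsP] at this
      omega
    by_cases h2 : v = t e
    · subst h2
      have := hstar' (t e)
      rw [hKQ _ htQ] at this
      omega
    rw [hstar v h1 h2]
    refine (Finset.card_le_card (Finset.erase_subset _ _)).trans ?_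
    rcases Finset.mem_union.1 hv with h3 | h3
    · rw [hKP v h3]; exact dP v h3
    · rw [hKQ v h3]; exact dQ v h3
  · intro v hv
    rw [Finset.mem_union, not_or] at hv
    rw [hstar v (fun h' => hv.1 (h' ▸ hsP)) (fun h' => hv.2 (h' ▸ htQ)), hout v hv.1 hv.2]
    exact Finset.card_le_card (Finset.erase_subset _ _)

/-- An edge set all of whose cuts have at least `k ≥ 4` edges contains a sparse edge set for which
the whole vertex set is tight, with degrees about `2d/k + 4`. -/
theorem exists_sparse_tight_degree_le {E : Finset β} {V : Finset α} {k : ℕ} (hk : 4 ≤ k)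
    (hne : V.Nonempty) (hE : ∀ e ∈ E, s e ∈ V ∧ t e ∈ V) (hloop : ∀ e ∈ E, s e ≠ t e)
    (hcut : ∀ X ⊆ V, X.Nonempty → X ≠ V → k ≤ (cut s t E X).card) (h : α → ℕ)
    (hh : ∀ v ∈ V, 2 * (starEdges s t E v).card + 4 * k ≤ k * h v + 8) :
    ∃ H ⊆ E, Sparse s t H ∧ Tight s t H V ∧ ∀ v ∈ V, (starEdges s t H v).card ≤ h v := by
  classical
  let F := E.powerset.filter fun H => Sparse s t H ∧ Tight s t H V
  have hF : F.Nonempty := by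
    obtain ⟨H, h1, h2, h3⟩ := exists_sparse_tight hk hne hE hcut
    exact ⟨H, by simp [F, h1, h2, h3]⟩
  -- The subtraction is truncated: only the excess over `h` is counted, and vertices below `h` do
  -- not compensate for it.
  obtain ⟨H, hHF, hmin⟩ := F.exists_min_image (fun H => ∑ v ∈ V, ((starEdges s t H v).card - h v)) hF
  simp only [F, Finset.mem_filter, Finset.mem_powerset] at hHF hmin
  obtain ⟨hHE, hH, hV⟩ := hHF
  refine ⟨H, hHE, hH, hV, ?_⟩
  by_contra hbad
  push Not at hbad
  obtain ⟨b, hbV, hb⟩ := hbad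
  -- Good sets are closed under union, so a good set `R` of maximum size absorbs all others.
  let Good : Finset α → Prop := fun R => ∀ x ∈ R, ∃ Y ⊆ R, Relaxable s t E H h x Y
  have hGu : ∀ {A B : Finset α}, Good A → Good B → Good (A ∪ B) := by
    intro A B hA hB x hx
    rcases Finset.mem_union.1 hx with h1 | h1
    · obtain ⟨Y, hY, hr⟩ := hA x h1
      exact ⟨Y, hY.trans Finset.subset_union_left, hr⟩
    · obtain ⟨Y, hY, hr⟩ := hB x h1
      exact ⟨Y, hY.trans Finset.subset_union_right, hr⟩
  let G := V.powerset.filter fun R => Good R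
  obtain ⟨R, hRG, hRmax⟩ := G.exists_max_image Finset.card ⟨∅, by simp [G, Good]⟩
  simp only [G, Finset.mem_filter, Finset.mem_powerset] at hRG hRmax
  obtain ⟨hRV, hR⟩ := hRG
  have hRabs : ∀ {B : Finset α}, B ⊆ V → Good (R ∪ B) → B ⊆ R := by
    intro B hB hg
    have h1 := hRmax _ ⟨Finset.union_subset hRV hB, hg⟩
    rw [Finset.eq_of_subset_of_card_le Finset.subset_union_left h1]
    exact Finset.subset_union_right
  -- A vertex of degree below `h` is relaxable by `H` itself inside the tight set `{v}`.
  have hslack : ∀ v ∈ V, v ∉ R → h v ≤ (starEdges s t H v).card := by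
    intro v hv hvR
    by_contra hlt
    push Not at hlt
    refine hvR (hRabs (B := {v}) (Finset.singleton_subset_iff.2 hv) (hGu hR ?_)
      (Finset.mem_singleton_self v))
    intro x hx
    rw [Finset.mem_singleton] at hx
    subst hx
    refine ⟨{x}, subset_rfl, tight_singleton H x, Finset.mem_singleton_self x, H, hHE, hH,
      fun _ _ => Iff.rfl, tight_singleton H x, hlt, ?_⟩
    intro v hv
    rw [Finset.mem_singleton] at hv
    subst hv
    exact hlt.le
  have hRle : ∀ v ∈ R, (starEdges s t H v).card ≤ h v := by
    intro x hx
    by_contra hlt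
    push Not at hlt
    obtain ⟨Y, hYR, hY, hxY, H', hH'E, hH', aH', tH', dx, dY⟩ := hR x hx
    have h1 := hmin H' ⟨hH'E, hH', aH'.tight (hYR.trans hRV) hH tH' hV⟩
    refine absurd h1 (not_le.2 (Finset.sum_lt_sum ?_ ⟨x, hRV hx, by omega⟩))
    intro v hv
    by_cases h2 : v ∈ Y
    · have := dY v h2
      omega
    · rw [aH'.star_eq h2]
  have hcl : ∀ e ∈ E, e ∉ H → s e ∈ R → t e ∈ R →
      ∃ Z ⊆ R, Tight s t H Z ∧ s e ∈ Z ∧ t e ∈ Z := by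
    intro e heE heH hs ht
    by_contra hno
    push Not at hno
    obtain ⟨P, hPR, rP⟩ := hR _ hs
    obtain ⟨Q, hQR, rQ⟩ := hR _ ht
    have hPQ : Disjoint P Q := by
      rw [Finset.disjoint_iff_inter_eq_empty]
      by_contra hne
      exact hno (P ∪ Q) (Finset.union_subset hPR hQR)
        (rP.1.union hH rQ.1 (Finset.nonempty_iff_ne_empty.2 hne))
        (Finset.mem_union_left _ rP.2.1) (Finset.mem_union_right _ rQ.2.1)
    obtain ⟨Y, hYV, hY, hsY, htY, hleast⟩ := hH.exists_least_tight hV (hRV hs) (hRV ht)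
    have key := fun (x : α) (hx : x ∈ Y) (hxR : x ∉ R) =>
      exchange hH heE heH rP rQ hPQ hY hsY htY hleast hx
        (fun h' => hxR (hPR h')) (fun h' => hxR (hQR h'))
    have hWV : Y ∪ P ∪ Q ⊆ V :=
      Finset.union_subset (Finset.union_subset hYV (hPR.trans hRV)) (hQR.trans hRV)
    -- If the least tight set `Y` spanning `e` contains a vertex outside `R` with excess, the
    -- exchange there reduces the total excess. If not, the exchange shows that all vertices of `Y`
    -- outside `R` are relaxable, and maximality puts `Y` inside `R`.
    by_cases hbY : ∃ x ∈ Y, x ∉ R ∧ h x < (starEdges s t H x).card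
    · obtain ⟨x, hx, hxR, hxb⟩ := hbY
      obtain ⟨hWt, H', hH'E, hH', aH', tH', dx, dPQ, dout⟩ := key x hx hxR
      have h1 := hmin H' ⟨hH'E, hH', aH'.tight hWV hH tH' hV⟩
      refine absurd h1 (not_le.2 (Finset.sum_lt_sum ?_ ⟨x, hYV hx, by omega⟩))
      intro v hv
      by_cases h2 : v ∈ P ∪ Q
      · have := dPQ v h2
        omega
      · have := dout v h2
        omega
    · push Not at hbY
      have hYR : Y ⊆ R := by
        refine hRabs hYV ?_
        intro x hx
        by_cases hxR : x ∈ R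
        · obtain ⟨Z, hZ, hr⟩ := hR x hxR
          exact ⟨Z, hZ.trans Finset.subset_union_left, hr⟩
        have hxY : x ∈ Y := (Finset.mem_union.1 hx).resolve_left hxR
        obtain ⟨hWt, H', hH'E, hH', aH', tH', dx, dPQ, dout⟩ := key x hxY hxR
        refine ⟨Y ∪ P ∪ Q, ?_, hWt, by simp [hxY], H', hH'E, hH', aH', tH',
          dx.trans_le (hbY x hxY hxR), ?_⟩
        · intro v hv
          simp only [Finset.mem_union] at hv ⊢
          rcases hv with (h1 | h1) | h1
          · exact Or.inr h1
          · exact Or.inl (hPR h1)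
          · exact Or.inl (hQR h1)
        · intro v hv
          by_cases h2 : v ∈ P ∪ Q
          · exact dPQ v h2
          · have hvY : v ∈ Y := by
              simp only [Finset.mem_union] at hv h2
              tauto
            refine (dout v h2).trans ?_
            by_cases hvR : v ∈ R
            · exact hRle v hvR
            · exact hbY v hvY hvR
      exact hno Y hYR hY hsY htY
  have hbR : b ∉ R := fun h' => absurd (hRle b h') (not_le.2 hb)
  -- The degrees outside `R` are now counted in two ways: from below by `hslack`, and exactly from
  -- the size `2|V| - 2` of `H` and the count inside `R`.
  obtain ⟨p, x, h1, h2⟩ := hH.count_parts hHE hRV hcut hcl (fun h' => hbR (h'.1 ▸ hbV))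
  have hHV : ∀ e ∈ H, s e ∈ V ∧ t e ∈ V := fun e he => hE e (hHE he)
  have hS : (V \ R).Nonempty := ⟨b, Finset.mem_sdiff.2 ⟨hbV, hbR⟩⟩
  have h3 := degree_sum (s := s) (t := t) (fun e he => hloop e (hHE he)) (V \ R)
  have h4 := degree_sum (s := s) (t := t) hloop (V \ R)
  have h5 := card_split (S := V \ R) hHV
  rw [Finset.sdiff_sdiff_eq_self hRV] at h5
  have h6 := cut_sdiff (S := R) hE
  have h7 : (inner s t H V).card = H.card := by
    congr 1
    exact Finset.filter_true_of_mem hHV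
  have h8 := hH V hne
  have h9 := hV.2
  have h10 := hH _ hS
  have h11 := Finset.card_le_card (inner_mono (s := s) (t := t) (Y := V \ R) hHE subset_rfl)
  have h12 := Finset.card_sdiff_add_card_eq_card hRV
  have h13 : ∑ v ∈ V \ R, h v ≤ ∑ v ∈ V \ R, (starEdges s t H v).card :=
    Finset.sum_le_sum fun v hv =>
      hslack v (Finset.mem_sdiff.1 hv).1 (Finset.mem_sdiff.1 hv).2
  have h14 : ∑ v ∈ V \ R, (2 * (starEdges s t E v).card + 4 * k) ≤ ∑ v ∈ V \ R, (k * h v + 8) :=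
    Finset.sum_le_sum fun v hv => hh v (Finset.mem_sdiff.1 hv).1
  rw [Finset.sum_add_distrib, Finset.sum_add_distrib, ← Finset.mul_sum _ _ 2,
    ← Finset.mul_sum _ _ k, Finset.sum_const, Finset.sum_const, smul_eq_mul, smul_eq_mul] at h14
  rw [h6] at h4
  rw [h7] at h8 h9
  generalize (∑ v ∈ V \ R, (starEdges s t H v).card) = a at *
  generalize (∑ v ∈ V \ R, (starEdges s t E v).card) = d at *
  generalize (∑ v ∈ V \ R, h v) = g at *
  generalize (inner s t H (V \ R)).card = iH at *
  generalize (inner s t E (V \ R)).card = iE at *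
  generalize (inner s t H R).card = rH at *
  generalize (cut s t E R).card = q at *
  generalize (cut s t H (V \ R)).card = qH at *
  generalize (V \ R).card = m at *
  generalize R.card = r at *
  generalize V.card = n at *
  generalize H.card = w at *
  have e1 : a + 2 + x = 2 * m + 2 * p + iH := by omega
  obtain ⟨j, rfl⟩ := Nat.exists_eq_add_of_le hk
  zify at *
  have e2 : (j : ℤ) * (iH + 2) ≤ j * (2 * m) := by gcongr
  have e3 : (4 + j : ℤ) * g ≤ (4 + j) * a := by gcongr
  have e4 : (0 : ℤ) ≤ j * x := by positivity
  have e5 : (a : ℤ) = 2 * m + 2 * p + iH - 2 - x := by linarith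
  rw [e5] at e3
  -- With `m` vertices outside `R` spanning `i` edges of `H`, the inequalities combine to `(k -
  -- 4)(2m - i + x) + 2k ≤ 0`, impossible because `i ≤ 2m - 2`.
  nlinarith

end EdgeCount

/-! ### Splitting a sparse tight set into two disjoint connected sets. -/

namespace EdgeCount

variable {α : Type*} {β : Type*} [DecidableEq α] [DecidableEq β]

/-- A cut of `V` induces a cut of `V \ {v}` unless it separates `v` from everything else, and then
`f` crosses it. Separate end functions are allowed because one edge will be given new ends. -/
theorem Connects.insert_pendant {s t s' t' : β → α} {T : Finset β} {V : Finset α} {v w : α} {f : β}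
    (hT : Connects s' t' T (V.erase v)) (hTv : ∀ e ∈ T, s' e ≠ v ∧ t' e ≠ v)
    (hends : ∀ e ∈ T, ∀ X, ¬(s' e ∈ X ↔ t' e ∈ X) → (cut s t (insert f T) X).Nonempty)
    (hwV : w ∈ V) (hwv : w ≠ v) (hf : s f = v ∧ t f = w ∨ s f = w ∧ t f = v) :
    Connects s t (insert f T) V := by
  intro X hXV hX hXne
  by_cases h1 : (X.erase v).Nonempty ∧ X.erase v ≠ V.erase v
  · obtain ⟨e, he⟩ := hT (X.erase v) (Finset.erase_subset_erase v hXV) h1.1 h1.2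
    rw [mem_cut] at he
    have h2 := hTv e he.1
    simp only [Finset.mem_erase, h2.1, h2.2, ne_eq, not_false_eq_true, true_and] at he
    exact hends e he.1 X he.2
  · have hvw : ¬(v ∈ X ↔ w ∈ X) := by
      by_cases h2 : (X.erase v).Nonempty
      · have h3 : X.erase v = V.erase v := by
          by_contra h4
          exact h1 ⟨h2, h4⟩
        have h4 : w ∈ X.erase v := h3 ▸ Finset.mem_erase.2 ⟨hwv, hwV⟩
        have h5 : v ∉ X := by
          intro h5
          refine hXne (hXV.antisymm fun y hy => ?_)
          by_cases hyv : y = v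
          · exact hyv ▸ h5
          · exact (Finset.mem_erase.1 (h3 ▸ Finset.mem_erase.2 ⟨hyv, hy⟩ : y ∈ X.erase v)).2
        simp [h5, (Finset.mem_erase.1 h4).2]
      · rw [Finset.not_nonempty_iff_eq_empty] at h2
        have h3 : ∀ y ∈ X, y = v := by
          intro y hy
          by_contra hyv
          have : y ∈ X.erase v := Finset.mem_erase.2 ⟨hyv, hy⟩
          simp [h2] at this
        obtain ⟨y, hy⟩ := hX
        have h4 : v ∈ X := h3 y hy ▸ hy
        have h5 : w ∉ X := fun h => hwv (h3 w h)
        simp [h4, h5]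
    refine ⟨f, mem_cut.2 ⟨Finset.mem_insert_self _ _, ?_⟩⟩
    rcases hf with ⟨h2, h3⟩ | ⟨h2, h3⟩ <;> rw [h2, h3] <;> tauto

theorem Sparse.ne {s t : β → α} {H : Finset β} (hH : Sparse s t H) {e : β} (he : e ∈ H) :
    s e ≠ t e := by
  intro h
  have h1 := hH {s e} (Finset.singleton_nonempty _)
  have h2 : 0 < (inner s t H {s e}).card :=
    Finset.card_pos.2 ⟨e, mem_inner.2 ⟨he, Finset.mem_singleton_self _, by simp [h]⟩⟩
  rw [Finset.card_singleton] at h1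
  omega

/-- A sparse edge set for which the whole vertex set is tight contains two disjoint connected
edge sets (Nash-Williams, Tutte). -/
theorem Sparse.exists_disjoint_connects (n : ℕ) : ∀ (s t : β → α) (H : Finset β) (V : Finset α),
    V.card = n → (∀ e ∈ H, s e ∈ V ∧ t e ∈ V) → Sparse s t H → Tight s t H V →
    ∃ T₁ ⊆ H, ∃ T₂ ⊆ H, Disjoint T₁ T₂ ∧ Connects s t T₁ V ∧ Connects s t T₂ V := by
  induction n with
  | zero =>
    intro s t H V hn _ _ hV
    have := Finset.card_pos.2 hV.1
    omega
  | succ n ih =>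
    intro s t H V hn hends hH hV
    have hHV : (inner s t H V).card = H.card := by
      congr 1
      exact Finset.filter_true_of_mem hends
    have hHc : H.card = 2 * n := by
      have h1 := hH V hV.1
      have h2 := hV.2
      omega
    rcases Nat.eq_zero_or_pos n with rfl | hnpos
    · refine ⟨∅, by simp, ∅, by simp, by simp, ?_, ?_⟩ <;>
      · intro X hXV hX hne
        refine absurd (Finset.eq_of_subset_of_card_le hXV ?_) hne
        have := Finset.card_pos.2 hX
        omega
    -- a vertex of degree two or three
    obtain ⟨v, hvV, hv3⟩ : ∃ v ∈ V, (starEdges s t H v).card ≤ 3 := by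
      by_contra! hcon
      have h1 := degree_sum (s := s) (t := t) (fun e he => hH.ne he) V
      have h2 : ∑ v ∈ V, 4 ≤ ∑ v ∈ V, (starEdges s t H v).card :=
        Finset.sum_le_sum fun v hv => hcon v hv
      have h3 : cut s t H V = ∅ := Finset.filter_eq_empty_iff.2 fun e he => by simp [hends e he]
      rw [Finset.sum_const, smul_eq_mul, h1, h3, Finset.card_empty] at h2
      omega
    have hinner : inner s t H (V.erase v) = H \ starEdges s t H v := by
      ext e
      simp only [mem_inner, Finset.mem_erase, Finset.mem_sdiff, mem_starEdges]
      constructor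
      · rintro ⟨h1, h2, h3⟩
        exact ⟨h1, fun h => h.2.elim h2.1 h3.1⟩
      · rintro ⟨h1, h2⟩
        exact ⟨h1, ⟨fun h => h2 ⟨h1, Or.inl h⟩, (hends e h1).1⟩,
          fun h => h2 ⟨h1, Or.inr h⟩, (hends e h1).2⟩
    have hstarH : starEdges s t H v ⊆ H := Finset.filter_subset _ _
    set H₀ := H \ starEdges s t H v with hH₀
    have hH₀H : H₀ ⊆ H := Finset.sdiff_subset
    have hH₀c : H₀.card + (starEdges s t H v).card = 2 * n := by
      rw [hH₀, Finset.card_sdiff_add_card_eq_card hstarH, hHc]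
    have hVc : (V.erase v).card = n := by rw [Finset.card_erase_of_mem hvV, hn]; simp
    have hVne : (V.erase v).Nonempty := Finset.card_pos.1 (by omega)
    have hH₀e : ∀ e ∈ H₀, s e ∈ V.erase v ∧ t e ∈ V.erase v := fun e he => by
      rw [← hinner] at he
      exact (mem_inner.1 he).2
    have hH₀s : Sparse s t H₀ := hH.mono hH₀H
    have hH₀i : (inner s t H₀ (V.erase v)).card = H₀.card := by
      congr 1
      exact Finset.filter_true_of_mem hH₀e
    have hv2 : 2 ≤ (starEdges s t H v).card := by
      have := hH₀s _ hVne
      omega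
    let o : β → α := fun e => if s e = v then t e else s e
    have ho : ∀ e ∈ starEdges s t H v, o e ∈ V ∧ o e ≠ v ∧ (s e = v ∧ t e = o e ∨ s e = o e ∧ t e = v) := by
      intro e he
      rw [mem_starEdges] at he
      have h1 := hends e he.1
      have h2 := hH.ne he.1
      by_cases h3 : s e = v
      · simp only [o, if_pos h3]
        exact ⟨h1.2, fun h => h2 (h3.trans h.symm), Or.inl ⟨h3, trivial⟩⟩
      · simp only [o, if_neg h3]
        exact ⟨h1.1, h3, Or.inr ⟨trivial, he.2.resolve_left h3⟩⟩
    have pendant : ∀ (T : Finset β) (f : β), T ⊆ H₀ → Connects s t T (V.erase v) →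
        f ∈ starEdges s t H v → Connects s t (insert f T) V := by
      intro T f hTH hT hf
      obtain ⟨h1, h2, h3⟩ := ho f hf
      refine hT.insert_pendant (fun e he => ?_) (fun e he X hX => ?_) h1 h2 h3
      · have := hH₀e e (hTH he)
        exact ⟨(Finset.mem_erase.1 this.1).1, (Finset.mem_erase.1 this.2).1⟩
      · exact ⟨e, mem_cut.2 ⟨Finset.mem_insert_of_mem he, hX⟩⟩
    have hnotin : ∀ {f}, f ∈ starEdges s t H v → f ∉ H₀ := fun hf h => (Finset.mem_sdiff.1 h).2 hf
    obtain h2 | h3 : (starEdges s t H v).card = 2 ∨ (starEdges s t H v).card = 3 := by omega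
    · obtain ⟨e₁, e₂, hne, hst⟩ := Finset.card_eq_two.1 h2
      have he₁ : e₁ ∈ starEdges s t H v := by simp [hst]
      have he₂ : e₂ ∈ starEdges s t H v := by simp [hst]
      obtain ⟨T₁, hT₁, T₂, hT₂, hd, c₁, c₂⟩ := ih s t H₀ (V.erase v) hVc hH₀e hH₀s
        ⟨hVne, by omega⟩
      refine ⟨insert e₁ T₁, Finset.insert_subset (hstarH he₁) (hT₁.trans hH₀H),
        insert e₂ T₂, Finset.insert_subset (hstarH he₂) (hT₂.trans hH₀H), ?_,
        pendant T₁ e₁ hT₁ c₁ he₁, pendant T₂ e₂ hT₂ c₂ he₂⟩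
      rw [Finset.disjoint_insert_left, Finset.disjoint_insert_right, Finset.mem_insert, not_or]
      exact ⟨⟨hne, fun h => hnotin he₁ (hT₂ h)⟩, fun h => hnotin he₂ (hT₁ h), hd⟩
    -- If two of the pairs of neighbours lay in tight sets, the union of these would be tight, and
    -- `v` with its three edges would make it span too much. Coinciding neighbours are also excluded
    -- by `hfree`, because a singleton is tight.
    · obtain ⟨e₁, e₂, e₃, he₁, he₂, he₃, h12, h13, h23, hfree⟩ : ∃ e₁ e₂ e₃,
          e₁ ∈ starEdges s t H v ∧ e₂ ∈ starEdges s t H v ∧ e₃ ∈ starEdges s t H v ∧ e₁ ≠ e₂ ∧ e₁ ≠ e₃ ∧ e₂ ≠ e₃ ∧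
          ∀ Y, Tight s t H₀ Y → ¬(o e₁ ∈ Y ∧ o e₂ ∈ Y) := by
        obtain ⟨e₁, e₂, e₃, h12, h13, h23, hst⟩ := Finset.card_eq_three.1 h3
        have he₁ : e₁ ∈ starEdges s t H v := by simp [hst]
        have he₂ : e₂ ∈ starEdges s t H v := by simp [hst]
        have he₃ : e₃ ∈ starEdges s t H v := by simp [hst]
        by_cases hA : ∀ Y, Tight s t H₀ Y → ¬(o e₁ ∈ Y ∧ o e₂ ∈ Y)
        · exact ⟨e₁, e₂, e₃, he₁, he₂, he₃, h12, h13, h23, hA⟩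
        by_cases hB : ∀ Y, Tight s t H₀ Y → ¬(o e₂ ∈ Y ∧ o e₃ ∈ Y)
        · exact ⟨e₂, e₃, e₁, he₂, he₃, he₁, h23, h12.symm, h13.symm, hB⟩
        exfalso
        push Not at hA hB
        obtain ⟨A, hA, hA1, hA2⟩ := hA
        obtain ⟨B, hB, hB2, hB3⟩ := hB
        have hY := hA.union hH₀s hB ⟨o e₂, Finset.mem_inter.2 ⟨hA2, hB2⟩⟩
        set Y := A ∪ B with hYdef
        have h1 : inner s t H₀ Y ∪ starEdges s t H v ⊆ inner s t H (insert v Y) := by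
          intro e he
          rcases Finset.mem_union.1 he with h | h
          · exact inner_mono hH₀H (Finset.subset_insert _ _) h
          · have h2 : o e ∈ Y := by
              have h3 := h
              rw [hst] at h3
              simp only [Finset.mem_insert, Finset.mem_singleton] at h3
              rcases h3 with rfl | rfl | rfl <;> simp [hYdef, hA1, hA2, hB3]
            obtain ⟨-, -, h4⟩ := ho e h
            refine mem_inner.2 ⟨hstarH h, ?_⟩
            rcases h4 with ⟨h5, h6⟩ | ⟨h5, h6⟩ <;> rw [h5, h6] <;> simp [h2]
        have h2 : Disjoint (inner s t H₀ Y) (starEdges s t H v) :=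
          Finset.disjoint_left.2 fun e h4 h5 => hnotin h5 (mem_inner.1 h4).1
        have h4 := Finset.card_le_card h1
        rw [Finset.card_union_of_disjoint h2] at h4
        have h5 := hH (insert v Y) (Finset.insert_nonempty _ _)
        have h6 := Finset.card_insert_le v Y
        have h7 := hY.2
        omega
      obtain ⟨o1V, o1v, o1⟩ := ho e₁ he₁
      obtain ⟨o2V, o2v, o2⟩ := ho e₂ he₂
      -- The name `e₁` is reused for the new edge between the neighbours `o e₁` and `o e₂`; hence
      -- the induction is over all end functions.
      let s' : β → α := Function.update s e₁ (o e₁)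
      let t' : β → α := Function.update t e₁ (o e₂)
      have hs'1 : s' e₁ = o e₁ := Function.update_self _ _ _
      have ht'1 : t' e₁ = o e₂ := Function.update_self _ _ _
      have hs' : ∀ e, e ≠ e₁ → s' e = s e := fun e he => Function.update_of_ne he _ _
      have ht' : ∀ e, e ≠ e₁ → t' e = t e := fun e he => Function.update_of_ne he _ _
      have hne1 : ∀ e ∈ H₀, e ≠ e₁ := fun e he h => hnotin he₁ (h ▸ he)
      have hends' : ∀ e ∈ insert e₁ H₀, s' e ∈ V.erase v ∧ t' e ∈ V.erase v := by
        intro e he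
        by_cases h : e = e₁
        · subst h
          rw [hs'1, ht'1]
          exact ⟨Finset.mem_erase.2 ⟨o1v, o1V⟩, Finset.mem_erase.2 ⟨o2v, o2V⟩⟩
        · rw [hs' e h, ht' e h]
          exact hH₀e e (Finset.mem_of_mem_insert_of_ne he h)
      have hin : ∀ Y, inner s' t' H₀ Y = inner s t H₀ Y := by
        intro Y
        refine Finset.filter_congr fun e he => ?_
        rw [hs' e (hne1 e he), ht' e (hne1 e he)]
      have hsp₀ : Sparse s' t' H₀ := fun Y hY => by rw [hin]; exact hH₀s Y hY
      have hsp : Sparse s' t' (insert e₁ H₀) := by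
        intro Y hY
        by_contra hlt
        obtain ⟨h1, h2, h4⟩ := hsp₀.tight_of_insert hY (not_le.1 hlt)
        rw [hs'1] at h2
        rw [ht'1] at h4
        exact hfree Y ⟨h1.1, by rw [← hin]; exact h1.2⟩ ⟨h2, h4⟩
      have htight : Tight s' t' (insert e₁ H₀) (V.erase v) := by
        refine ⟨hVne, ?_⟩
        have h1 : inner s' t' (insert e₁ H₀) (V.erase v) = insert e₁ H₀ :=
          Finset.filter_true_of_mem hends'
        rw [h1, Finset.card_insert_of_notMem (hnotin he₁)]
        omega
      obtain ⟨T₁, hT₁, T₂, hT₂, hd, c₁, c₂⟩ := ih s' t' _ (V.erase v) hVc hends' hsp htight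
      -- `A` is the set that may use the new edge: with `e₂` added, the path through `v` replaces
      -- that edge, or `v` is pendant. `B` gets `v` through `e₃`.
      have build : ∀ A B : Finset β, A ⊆ insert e₁ H₀ → B ⊆ H₀ → Disjoint A B →
          Connects s' t' A (V.erase v) → Connects s' t' B (V.erase v) →
          ∃ T₁ ⊆ H, ∃ T₂ ⊆ H, Disjoint T₁ T₂ ∧ Connects s t T₁ V ∧ Connects s t T₂ V := by
        intro A B hA hB hAB cA cB
        refine ⟨insert e₂ A, Finset.insert_subset (hstarH he₂)
          (hA.trans (Finset.insert_subset (hstarH he₁) hH₀H)), insert e₃ B,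
          Finset.insert_subset (hstarH he₃) (hB.trans hH₀H), ?_, ?_, pendant B e₃ hB ?_ he₃⟩
        · rw [Finset.disjoint_insert_left, Finset.disjoint_insert_right, Finset.mem_insert, not_or]
          refine ⟨⟨h23, fun h => hnotin he₂ (hB h)⟩, fun h => ?_, hAB⟩
          rcases Finset.mem_insert.1 (hA h) with h | h
          · exact h13 h.symm
          · exact hnotin he₃ h
        · refine cA.insert_pendant (fun e he => ?_) (fun e he X hX => ?_) o2V o2v o2
          · have := hends' e (hA he)
            exact ⟨(Finset.mem_erase.1 this.1).1, (Finset.mem_erase.1 this.2).1⟩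
          · by_cases h : e = e₁
            · subst h
              rw [hs'1, ht'1] at hX
              by_cases h4 : v ∈ X ↔ o e ∈ X
              · refine ⟨e₂, mem_cut.2 ⟨Finset.mem_insert_self _ _, ?_⟩⟩
                rcases o2 with ⟨h5, h6⟩ | ⟨h5, h6⟩ <;> rw [h5, h6] <;> tauto
              · refine ⟨e, mem_cut.2 ⟨Finset.mem_insert_of_mem he, ?_⟩⟩
                rcases o1 with ⟨h5, h6⟩ | ⟨h5, h6⟩ <;> rw [h5, h6] <;> tauto
            · rw [hs' e h, ht' e h] at hX
              exact ⟨e, mem_cut.2 ⟨Finset.mem_insert_of_mem he, hX⟩⟩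
        · intro X hXV hX hXne
          obtain ⟨e, he⟩ := cB X hXV hX hXne
          rw [mem_cut] at he
          rw [hs' e (hne1 e (hB he.1)), ht' e (hne1 e (hB he.1))] at he
          exact ⟨e, mem_cut.2 he⟩
      have avoid : ∀ {A : Finset β}, A ⊆ insert e₁ H₀ → e₁ ∉ A → A ⊆ H₀ := fun hA h e he =>
        Finset.mem_of_mem_insert_of_ne (hA he) fun h' => h (h' ▸ he)
      by_cases h : e₁ ∈ T₂
      · exact build T₂ T₁ hT₂ (avoid hT₁ fun h' => Finset.disjoint_left.1 hd h' h) hd.symm c₂ c₁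
      · exact build T₁ T₂ hT₁ (avoid hT₂ h) hd c₁ c₂

end EdgeCount

/-! ### Prescribed parities inside a connected edge set. -/

namespace EdgeCount

open scoped symmDiff

variable {α : Type*} {β : Type*} [DecidableEq α] [DecidableEq β] {s t : β → α}

/-- The degree of `v` modulo two. -/
def parity (s t : β → α) (J : Finset β) (v : α) : ZMod 2 := ((starEdges s t J v).card : ZMod 2)

theorem parity_symmDiff (J K : Finset β) (v : α) :
    parity s t (J ∆ K) v = parity s t J v + parity s t K v := by
  have h1 : starEdges s t (J ∆ K) v = starEdges s t J v ∆ starEdges s t K v := by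
    ext e
    simp only [mem_starEdges, Finset.mem_symmDiff]
    tauto
  have h2 : ∀ A B : Finset β, (A ∆ B).card + 2 * (A ∩ B).card = A.card + B.card := by
    intro A B
    have h3 : (A ∆ B).card = (A \ B).card + (B \ A).card :=
      Finset.card_union_of_disjoint disjoint_sdiff_sdiff
    have h4 := Finset.card_sdiff_add_card_inter A B
    have h5 := Finset.card_sdiff_add_card_inter B A
    rw [Finset.inter_comm] at h5
    omega
  have h3 := congrArg (Nat.cast : ℕ → ZMod 2) (h2 (starEdges s t J v) (starEdges s t K v))
  push_cast at h3
  rw [show (2 : ZMod 2) = 0 from rfl, zero_mul, add_zero] at h3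
  rw [parity, h1, h3, parity, parity]

theorem parity_eq_zero {J : Finset β} {v : α} : parity s t J v = 0 ↔ Even (starEdges s t J v).card :=
  ZMod.natCast_eq_zero_iff_even

/-- The vertices `y` that can be paired with `x` form a set that no edge of `T` leaves, since
toggling an edge moves the second odd vertex along it. For `y = x` the two ones cancel modulo two.
-/
theorem Connects.exists_pair_join {T : Finset β} {V : Finset α} (hT : Connects s t T V)
    (hTV : ∀ e ∈ T, s e ∈ V ∧ t e ∈ V) (hloop : ∀ e ∈ T, s e ≠ t e) {x y : α} (hx : x ∈ V)
    (hy : y ∈ V) :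
    ∃ J ⊆ T, ∀ v, parity s t J v = (if v = x then 1 else 0) + if v = y then 1 else 0 := by
  classical
  set C := V.filter fun y => ∃ J ⊆ T, ∀ v, parity s t J v =
    (if v = x then 1 else 0) + if v = y then 1 else 0 with hC
  have hxC : x ∈ C := by
    refine Finset.mem_filter.2 ⟨hx, ∅, by simp, fun v => ?_⟩
    by_cases h : v = x
    · simp only [parity, starEdges, h, if_true, Finset.filter_empty, Finset.card_empty]
      decide
    · simp [parity, starEdges, h]
  by_cases hCV : C = V
  · exact (Finset.mem_filter.1 (hCV ▸ hy : y ∈ C)).2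
  obtain ⟨e, he⟩ := hT C (Finset.filter_subset _ _) ⟨x, hxC⟩ hCV
  rw [mem_cut] at he
  have hV := hTV e he.1
  have hne := hloop e he.1
  exfalso
  have step : ∀ a b, a ∈ C → b ∉ C → b ∈ V → (s e = a ∧ t e = b ∨ s e = b ∧ t e = a) → False := by
    intro a b ha hb hbV hab
    obtain ⟨-, J, hJ, hpar⟩ := Finset.mem_filter.1 ha
    refine hb (Finset.mem_filter.2 ⟨hbV, J ∆ {e}, ?_, fun v => ?_⟩)
    · intro f hf
      rcases Finset.mem_symmDiff.1 hf with h | h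
      · exact hJ h.1
      · exact Finset.mem_singleton.1 h.1 ▸ he.1
    · have h1 : parity s t {e} v = (if v = a then 1 else 0) + if v = b then 1 else 0 := by
        have hab' : a ≠ b := fun h => hb (h ▸ ha)
        have h2 : starEdges s t {e} v = if v = a ∨ v = b then {e} else ∅ := by
          ext f
          rcases hab with ⟨h3, h4⟩ | ⟨h3, h4⟩ <;> split_ifs with h5 <;>
            simp [mem_starEdges] <;> grind
        rw [parity, h2]
        by_cases h3 : v = a
        · have h4 : v ≠ b := fun h => hab' (h3 ▸ h)
          simp [h3, hab']
        · by_cases h4 : v = b <;> simp [h3, h4]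
          intro h; exact absurd h.symm hab'
      rw [parity_symmDiff, hpar, h1]
      have h2 : ∀ p q r : ZMod 2, p + q + (q + r) = p + r := by decide
      exact h2 _ _ _
  by_cases h1 : s e ∈ C
  · exact step (s e) (t e) h1 (by tauto) hV.2 (Or.inl ⟨rfl, rfl⟩)
  · exact step (t e) (s e) (by tauto) h1 hV.1 (Or.inr ⟨rfl, rfl⟩)

theorem Connects.exists_join {T : Finset β} {V : Finset α} (hT : Connects s t T V)
    (hTV : ∀ e ∈ T, s e ∈ V ∧ t e ∈ V) (hloop : ∀ e ∈ T, s e ≠ t e) (n : ℕ) :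
    ∀ O ⊆ V, O.card = 2 * n → ∃ J ⊆ T, ∀ v, parity s t J v = if v ∈ O then 1 else 0 := by
  induction n with
  | zero =>
    intro O _ hO
    rw [mul_zero, Finset.card_eq_zero] at hO
    subst hO
    exact ⟨∅, by simp, fun v => by simp [parity, starEdges]⟩
  | succ n ih =>
    intro O hOV hO
    obtain ⟨x, hx, y, hy, hxy⟩ := Finset.one_lt_card.1 (show 1 < O.card by omega)
    have h1 : ((O.erase x).erase y).card = 2 * n := by
      rw [Finset.card_erase_of_mem (Finset.mem_erase.2 ⟨hxy.symm, hy⟩),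
        Finset.card_erase_of_mem hx]
      omega
    obtain ⟨J, hJ, hJp⟩ := ih _ (((Finset.erase_subset _ _).trans (Finset.erase_subset _ _)).trans hOV) h1
    obtain ⟨K, hK, hKp⟩ := hT.exists_pair_join hTV hloop (hOV hx) (hOV hy)
    refine ⟨J ∆ K, fun e he => ?_, fun v => ?_⟩
    · rcases Finset.mem_symmDiff.1 he with h | h
      · exact hJ h.1
      · exact hK h.1
    · rw [parity_symmDiff, hJp, hKp]
      by_cases h2 : v = x
      · subst h2
        simp [hx, hxy]
      · by_cases h3 : v = y
        · subst h3
          simp [hy, h2]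
        · simp [h2, h3]

/-- Two disjoint connected edge sets contain a connected edge set with even degrees. -/
theorem Connects.exists_even {T₁ T₂ : Finset β} {V : Finset α} (h₁ : Connects s t T₁ V)
    (h₂ : Connects s t T₂ V) (hd : Disjoint T₁ T₂) (h₁V : ∀ e ∈ T₁, s e ∈ V ∧ t e ∈ V)
    (h₂V : ∀ e ∈ T₂, s e ∈ V ∧ t e ∈ V) (h₁l : ∀ e ∈ T₁, s e ≠ t e) (h₂l : ∀ e ∈ T₂, s e ≠ t e) :
    ∃ K ⊆ T₁ ∪ T₂, Connects s t K V ∧ ∀ v ∈ V, Even (starEdges s t K v).card := by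
  classical
  have h1 := degree_sum h₁l V
  have h2 : cut s t T₁ V = ∅ := Finset.filter_eq_empty_iff.2 fun e he => by simp [h₁V e he]
  rw [h2, Finset.card_empty, zero_add] at h1
  have h3 : Even (V.filter fun v => Odd (starEdges s t T₁ v).card).card := by
    rw [← Finset.even_sum_iff_even_card_odd, h1]
    exact even_two_mul _
  obtain ⟨n, hn⟩ := h3
  -- `J` is odd exactly where `T₁` is. Being disjoint from `T₁`, it corrects the parities without
  -- deleting any edge of `T₁`, so connectedness is kept.
  obtain ⟨J, hJ, hpar⟩ := h₂.exists_join h₂V h₂l n _ (Finset.filter_subset _ _)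
    (hn.trans (two_mul n).symm)
  have hJd : Disjoint T₁ J := Finset.disjoint_of_subset_right hJ hd
  refine ⟨T₁ ∆ J, ?_, ?_, fun v hv => ?_⟩
  · intro e he
    rcases Finset.mem_symmDiff.1 he with h | h
    · exact Finset.mem_union_left _ h.1
    · exact Finset.mem_union_right _ (hJ h.1)
  · intro X hXV hX hne
    obtain ⟨e, he⟩ := h₁ X hXV hX hne
    rw [mem_cut] at he
    exact ⟨e, mem_cut.2 ⟨Finset.mem_symmDiff.2 (Or.inl ⟨he.1, Finset.disjoint_left.1 hJd he.1⟩), he.2⟩⟩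
  · rw [← parity_eq_zero, parity_symmDiff, hpar]
    by_cases h : Odd (starEdges s t T₁ v).card
    · rw [if_pos (Finset.mem_filter.2 ⟨hv, h⟩), parity, ZMod.natCast_eq_one_iff_odd.2 h]
      decide
    · rw [if_neg (fun h' : v ∈ V.filter _ => h (Finset.mem_filter.1 h').2), add_zero, parity_eq_zero]
      exact Nat.not_odd_iff_even.1 h

/-- An edge set all of whose cuts have at least `k ≥ 4` edges contains a connected edge set
with even degrees of about `2d/k + 4` at most. -/
theorem exists_connects_even_degree_le {E : Finset β} {V : Finset α} {k : ℕ} (hk : 4 ≤ k)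
    (hne : V.Nonempty) (hE : ∀ e ∈ E, s e ∈ V ∧ t e ∈ V) (hloop : ∀ e ∈ E, s e ≠ t e)
    (hcut : ∀ X ⊆ V, X.Nonempty → X ≠ V → k ≤ (cut s t E X).card) (h : α → ℕ)
    (hh : ∀ v ∈ V, 2 * (starEdges s t E v).card + 4 * k ≤ k * h v + 8) :
    ∃ K ⊆ E, Connects s t K V ∧ ∀ v ∈ V, Even (starEdges s t K v).card ∧ (starEdges s t K v).card ≤ h v := by
  obtain ⟨H, hHE, hH, hV, hdeg⟩ := exists_sparse_tight_degree_le hk hne hE hloop hcut h hh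
  obtain ⟨T₁, h₁, T₂, h₂, hd, c₁, c₂⟩ := Sparse.exists_disjoint_connects _ s t H V rfl
    (fun e he => hE e (hHE he)) hH hV
  obtain ⟨K, hK, cK, hev⟩ := c₁.exists_even c₂ hd (fun e he => hE e (hHE (h₁ he)))
    (fun e he => hE e (hHE (h₂ he))) (fun e he => hloop e (hHE (h₁ he)))
    (fun e he => hloop e (hHE (h₂ he)))
  have hKH : K ⊆ H := hK.trans (Finset.union_subset h₁ h₂)
  refine ⟨K, hKH.trans hHE, cK, fun v hv => ⟨hev v hv, (Finset.card_le_card ?_).trans (hdeg v hv)⟩⟩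
  exact Finset.filter_subset_filter _ hKH

end EdgeCount

/-! ### Edge cuts, walks and Euler trails in multigraphs. -/

namespace Graph

open EdgeCount

variable {α : Type u} {β : Type v} {G : Graph α β} {s t : β → α}

theorem exists_ends (G : Graph α β) (hne : V(G).Nonempty) :
    ∃ s t : β → α, ∀ e ∈ E(G), G.IsLink e (s e) (t e) := by
  obtain ⟨x, -⟩ := hne
  have : ∀ e, ∃ a b : α, e ∈ E(G) → G.IsLink e a b := by
    intro e
    by_cases he : e ∈ E(G)
    · obtain ⟨a, b, hab⟩ := exists_isLink_of_mem_edgeSet he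
      exact ⟨a, b, fun _ => hab⟩
    · exact ⟨x, x, fun h => absurd h he⟩
  choose s t hst using this
  exact ⟨s, t, hst⟩

theorem inc_iff_ends (hst : ∀ e ∈ E(G), G.IsLink e (s e) (t e)) {e : β} (he : e ∈ E(G)) {v : α} :
    G.Inc e v ↔ s e = v ∨ t e = v := by
  constructor
  · intro h
    exact (h.eq_or_eq_of_isLink (hst e he)).imp Eq.symm Eq.symm
  · rintro (rfl | rfl)
    · exact (hst e he).inc_left
    · exact (hst e he).inc_right

theorem degree_eq_card_starEdges [DecidableEq α] [DecidableEq β] (hE : E(G).Finite)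
    (hst : ∀ e ∈ E(G), G.IsLink e (s e) (t e)) (v : α) :
    G.degree v = (starEdges s t hE.toFinset v).card := by
  rw [degree, ← Set.ncard_coe_finset]
  congr 1
  ext e
  simp only [mem_incidenceSet, Finset.mem_coe, mem_starEdges, Set.Finite.mem_toFinset]
  exact ⟨fun h => ⟨h.edge_mem, (inc_iff_ends hst h.edge_mem).1 h⟩,
    fun h => (inc_iff_ends hst h.1).2 h.2⟩

theorem EdgeConnected.le_card_cut [DecidableEq α] [DecidableEq β] {k : ℕ} (hG : G.EdgeConnected k)
    (hV : V(G).Finite) (hE : E(G).Finite) (hst : ∀ e ∈ E(G), G.IsLink e (s e) (t e))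
    {X : Finset α} (hXV : X ⊆ hV.toFinset) (hX : X.Nonempty) (hne : X ≠ hV.toFinset) :
    k ≤ (cut s t hE.toFinset X).card := by
  by_contra hlt
  obtain ⟨-, hconn⟩ := hG (cut s t hE.toFinset X)
    (fun e he => by simpa using (mem_cut.1 he).1) (not_le.1 hlt)
  have stays : ∀ {x y}, (G.deleteEdges (cut s t hE.toFinset X : Set β)).Walk x y →
      x ∈ X → y ∈ X := by
    intro x y p
    induction p with
    | nil _ => exact id
    | @cons x y z e h p ih =>
      intro hx
      refine ih ?_
      simp only [deleteEdges_isLink, Finset.mem_coe] at h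
      have he := h.1.edge_mem
      by_contra hy
      refine h.2 (mem_cut.2 ⟨by simpa using he, ?_⟩)
      rcases h.1.eq_and_eq_or_eq_and_eq (hst e he) with ⟨rfl, rfl⟩ | ⟨rfl, rfl⟩ <;> tauto
  obtain ⟨x, hx⟩ := hX
  refine hne (hXV.antisymm fun y hy => ?_)
  obtain ⟨p⟩ := hconn x (by simpa using hXV hx) y (by simpa using hy)
  exact stays p hx

theorem EdgeConnected.nonempty {k : ℕ} (hk : 0 < k) (hG : G.EdgeConnected k) : V(G).Nonempty := by
  simpa using (hG ∅ (by simp) (by simpa using hk)).1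

namespace Walk

/-- Concatenation of walks. -/
def append {x y z : α} : G.Walk x y → G.Walk y z → G.Walk x z
  | nil _, q => q
  | cons e h p, q => cons e h (p.append q)

theorem edges_append {x y z : α} (p : G.Walk x y) (q : G.Walk y z) :
    (p.append q).edges = p.edges ++ q.edges := by
  induction p with
  | nil _ => rfl
  | cons e h p ih => simp [append, edges, ih]

theorem mem_vertexSet_of_mem_support {x y z : α} (p : G.Walk x y) (hz : z ∈ p.support) :
    z ∈ V(G) := by
  induction p with
  | nil hx => simp only [support, List.mem_singleton] at hz; exact hz ▸ hx
  | cons e h p ih =>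
    simp only [support, List.mem_cons] at hz
    rcases hz with rfl | hz
    · exact h.left_mem
    · exact ih hz

theorem left_mem_support {x y : α} (p : G.Walk x y) : x ∈ p.support := by
  cases p <;> simp [support]

theorem right_mem_support {x y : α} (p : G.Walk x y) : y ∈ p.support := by
  induction p with
  | nil _ => simp [support]
  | cons e h p ih => simp [support, ih]

theorem inc_of_mem_edges {x y z : α} (p : G.Walk x y) {e : β} (he : e ∈ p.edges)
    (hz : G.Inc e z) : z ∈ p.support := by
  induction p with
  | nil _ => simp [edges] at he
  | cons f h p ih =>
    simp only [edges, List.mem_cons] at he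
    rcases he with rfl | he
    · rcases hz.eq_or_eq_of_isLink h with rfl | rfl
      · simp [support]
      · simp [support, left_mem_support]
    · exact List.mem_cons_of_mem _ (ih he)

theorem exists_split {x y z : α} (p : G.Walk x y) (hz : z ∈ p.support) :
    ∃ (q : G.Walk x z) (r : G.Walk z y), p.edges = q.edges ++ r.edges := by
  induction p with
  | nil hx =>
    simp only [support, List.mem_singleton] at hz
    subst hz
    exact ⟨nil hx, nil hx, rfl⟩
  | cons e h p ih =>
    simp only [support, List.mem_cons] at hz
    rcases hz with rfl | hz
    · exact ⟨nil h.left_mem, cons e h p, rfl⟩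
    · obtain ⟨q, r, hqr⟩ := ih hz
      exact ⟨cons e h q, r, by simp [edges, hqr]⟩

open Classical in
-- Every occurrence of `z` on the walk touches two of its edges, except that the first and the last
-- occurrence each lack one.
theorem countP_edges [G.Loopless] (hst : ∀ e ∈ E(G), G.IsLink e (s e) (t e)) {x y : α}
    (p : G.Walk x y) (z : α) :
    p.edges.countP (fun e => s e = z ∨ t e = z) + (if z = x then 1 else 0) +
      (if z = y then 1 else 0) = 2 * p.support.count z := by
  induction p with
  | @nil x hx =>
    by_cases h : z = x
    · simp [edges, support, h]
    · have h' : ¬ x = z := fun h' => h h'.symm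
      simp [edges, support, h, h']
  | @cons x w y e h p ih =>
    have hxw : x ≠ w := h.ne
    simp only [edges, support, List.countP_cons, List.count_cons, beq_iff_eq]
    have h1 : (decide (s e = z ∨ t e = z) = true) ↔ (z = x ∨ z = w) := by
      rw [decide_eq_true_iff]
      rcases h.eq_and_eq_or_eq_and_eq (hst e h.edge_mem) with ⟨rfl, rfl⟩ | ⟨rfl, rfl⟩ <;>
        simp only [eq_comm (a := z)]
      exact or_comm
    simp only [h1, eq_comm (a := x)]
    by_cases h2 : z = x
    · subst h2
      simp only [hxw, if_true, if_false, true_or] at ih ⊢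
      omega
    · by_cases h3 : z = w
      · subst h3
        simp only [h2, if_true, if_false, or_true] at ih ⊢
        omega
      · simp only [h2, h3, if_false, or_false] at ih ⊢
        omega

open Classical in
theorem card_star_edges {p : List β} (hp : p.Nodup) (z : α) :
    (starEdges s t p.toFinset z).card = p.countP (fun e => s e = z ∨ t e = z) := by
  have h : starEdges s t p.toFinset z = (p.filter fun e => s e = z ∨ t e = z).toFinset := by
    ext e
    simp [mem_starEdges]
  rw [h, List.toFinset_card_of_nodup (hp.filter _), List.countP_eq_length_filter]

theorem length_edges_le [DecidableEq β] {p : List β} (hp : p.Nodup) {L : Finset β}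
    (hL : ∀ e ∈ p, e ∈ L) : p.length ≤ L.card := by
  rw [← List.toFinset_card_of_nodup hp]
  exact Finset.card_le_card fun e he => hL e (List.mem_toFinset.1 he)

open Classical in
/-- In an edge set with even degrees, there is a nontrivial closed trail from every end of an
edge. -/
theorem exists_closed_trail [G.Loopless] (hst : ∀ e ∈ E(G), G.IsLink e (s e) (t e)) {L : Finset β}
    (hLE : ∀ e ∈ L, e ∈ E(G)) (hev : ∀ v ∈ V(G), Even (starEdges s t L v).card) {u : α} {e : β}
    (he : e ∈ starEdges s t L u) :
    ∃ q : G.Walk u u, q.edges.Nodup ∧ (∀ f ∈ q.edges, f ∈ L) ∧ q.edges ≠ [] := by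
  by_contra! hno
  have link : ∀ {f w}, f ∈ starEdges s t L w → ∃ w', G.IsLink f w w' := by
    intro f w hf
    rw [mem_starEdges] at hf
    exact (inc_iff_ends hst (hLE f hf.1)).2 hf.2
  -- A trail from `u` that never returns uses an odd number of edges at its last vertex, so an
  -- unused edge of `L` remains there and the trail can grow without bound.
  have long : ∀ n : ℕ, ∃ (y : α) (p : G.Walk u y), p.edges.Nodup ∧ (∀ f ∈ p.edges, f ∈ L) ∧
      p.edges.length = n + 1 := by
    intro n
    induction n with
    | zero =>
      obtain ⟨w, hw⟩ := link he
      exact ⟨w, cons e hw (nil hw.right_mem), by simp [edges], by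
        simpa [edges] using (mem_starEdges.1 he).1, by simp [edges]⟩
    | succ n ih =>
      obtain ⟨y, p, hnd, hL, hlen⟩ := ih
      by_cases hy : y = u
      · subst hy
        have := hno p hnd hL
        simp [this] at hlen
      have hcount := countP_edges hst p y
      rw [← card_star_edges hnd, if_neg hy, if_pos rfl] at hcount
      have hyV := p.mem_vertexSet_of_mem_support p.right_mem_support
      obtain ⟨m, hm⟩ := hev y hyV
      have hsub : starEdges s t p.edges.toFinset y ⊆ starEdges s t L y :=
        Finset.filter_subset_filter _ fun f hf => hL f (List.mem_toFinset.1 hf)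
      obtain ⟨f, hf, hfp⟩ := Finset.exists_mem_notMem_of_card_lt_card
        (s := starEdges s t p.edges.toFinset y) (t := starEdges s t L y) (by
          have := Finset.card_le_card hsub
          omega)
      obtain ⟨w, hw⟩ := link hf
      have hfp' : f ∉ p.edges := fun h => hfp (mem_starEdges.2 ⟨List.mem_toFinset.2 h, (mem_starEdges.1 hf).2⟩)
      refine ⟨w, p.append (cons f hw (nil hw.right_mem)), ?_, ?_, ?_⟩
      · rw [edges_append]
        exact List.Nodup.append hnd (by simp [edges]) (by simpa [edges] using hfp')
      · intro g hg
        rw [edges_append] at hg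
        simp only [edges, List.mem_append, List.mem_singleton] at hg
        rcases hg with hg | rfl
        · exact hL g hg
        · exact (mem_starEdges.1 hf).1
      · simp [edges_append, edges, hlen]
  obtain ⟨y, p, hnd, hL, hlen⟩ := long L.card
  have := length_edges_le hnd hL
  omega

open Classical in
/-- A connected edge set with even degrees contains a spanning closed trail (Euler). -/
theorem exists_spanning_closed_trail [G.Loopless] (hV : V(G).Finite) (hne : V(G).Nonempty)
    (hst : ∀ e ∈ E(G), G.IsLink e (s e) (t e)) {K : Finset β} (hKE : ∀ e ∈ K, e ∈ E(G))
    (hK : Connects s t K hV.toFinset) (hev : ∀ v ∈ V(G), Even (starEdges s t K v).card) :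
    ∃ (x : α) (p : G.Walk x x), p.IsTrail ∧ p.IsSpanning ∧ (∀ e ∈ p.edges, e ∈ K) := by
  obtain ⟨x, hx⟩ := hne
  refine ⟨x, ?_⟩
  by_contra! hno
  have long : ∀ n : ℕ, ∃ p : G.Walk x x, p.edges.Nodup ∧ (∀ f ∈ p.edges, f ∈ K) ∧
      n ≤ p.edges.length := by
    intro n
    induction n with
    | zero => exact ⟨nil hx, by simp [edges], by simp [edges], by simp⟩
    | succ n ih =>
      obtain ⟨p, hnd, hpK, hlen⟩ := ih
      have hns : ¬ p.IsSpanning := fun h => by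
        obtain ⟨e, he, heK⟩ := hno p hnd h
        exact heK (hpK e he)
      simp only [IsSpanning, not_forall] at hns
      obtain ⟨w, hwV, hwp⟩ := hns
      -- Some edge of `K` leaves the set of visited vertices. The unused edges have even degrees, so
      -- they contain a closed trail from a visited end of it, which is spliced into `p`.
      obtain ⟨e, he⟩ := hK p.support.toFinset
        (fun y hy => by simpa using p.mem_vertexSet_of_mem_support (List.mem_toFinset.1 hy))
        ⟨x, List.mem_toFinset.2 p.left_mem_support⟩
        (fun h => hwp (List.mem_toFinset.1 (h ▸ (by simpa using hwV))))
      simp only [mem_cut, List.mem_toFinset] at he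
      have heE := hKE e he.1
      have hep : e ∉ p.edges := fun h => he.2
        ⟨fun _ => p.inc_of_mem_edges h (hst e heE).inc_right,
         fun _ => p.inc_of_mem_edges h (hst e heE).inc_left⟩
      obtain ⟨u, hu, hue⟩ : ∃ u ∈ p.support, s e = u ∨ t e = u := by
        by_cases h : s e ∈ p.support
        · exact ⟨_, h, Or.inl rfl⟩
        · exact ⟨t e, by tauto, Or.inr rfl⟩
      have hstar : ∀ v, (starEdges s t (K \ p.edges.toFinset) v).card + (starEdges s t p.edges.toFinset v).card =
          (starEdges s t K v).card := by
        intro v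
        rw [← Finset.card_sdiff_add_card_eq_card (s := starEdges s t p.edges.toFinset v)
          (t := starEdges s t K v)
          (Finset.filter_subset_filter _ fun f hf => hpK f (List.mem_toFinset.1 hf))]
        congr 2
        ext f
        simp only [mem_starEdges, Finset.mem_sdiff]
        tauto
      obtain ⟨q, hq, hqL, hqne⟩ := exists_closed_trail hst (L := K \ p.edges.toFinset)
        (fun f hf => hKE f (Finset.mem_sdiff.1 hf).1) (fun v hv => by
          have h1 := countP_edges hst p v
          rw [← card_star_edges hnd] at h1
          have h2 := hstar v
          obtain ⟨m, hm⟩ := hev v hv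
          by_cases h3 : v = x
          · simp only [h3, if_true] at h1 h2 hm ⊢
            exact (Nat.even_iff.2 (by omega))
          · simp only [h3, if_false] at h1
            exact (Nat.even_iff.2 (by omega)))
        (u := u) (e := e) (mem_starEdges.2 ⟨Finset.mem_sdiff.2 ⟨he.1, by simpa using hep⟩, hue⟩)
      obtain ⟨a, b, hab⟩ := p.exists_split hu
      have hperm : (a.append (q.append b)).edges.Perm (p.edges ++ q.edges) := by
        rw [edges_append, edges_append, hab, List.append_assoc]
        exact List.Perm.append_left _ List.perm_append_comm
      refine ⟨a.append (q.append b), ?_, ?_, ?_⟩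
      · rw [hperm.nodup_iff]
        refine List.Nodup.append hnd hq fun f hf hf' => ?_
        have := (Finset.mem_sdiff.1 (hqL f hf')).2
        simp [hf] at this
      · intro f hf
        rcases List.mem_append.1 (hperm.mem_iff.1 hf) with h | h
        · exact hpK f h
        · exact (Finset.mem_sdiff.1 (hqL f h)).1
      · rw [hperm.length_eq, List.length_append]
        have := List.length_pos_iff.2 hqne
        omega
  obtain ⟨p, hnd, hpK, hlen⟩ := long (K.card + 1)
  have := length_edges_le hnd hpK
  omega

open Classical in
theorem two_mul_visits [G.Loopless] (hst : ∀ e ∈ E(G), G.IsLink e (s e) (t e)) {x : α}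
    (p : G.Walk x x) (hp : p.edges ≠ []) (z : α) :
    2 * p.visits z = p.edges.countP (fun e => s e = z ∨ t e = z) := by
  have h1 := countP_edges hst p z
  rw [visits, if_neg hp]
  have h2 : p.support = x :: p.support.tail := by cases p <;> simp [support]
  rw [h2, List.count_cons] at h1
  simp only [beq_iff_eq, eq_comm (a := x)] at h1
  by_cases h3 : z = x <;> simp only [h3, if_true, if_false] at h1 ⊢ <;> omega

open Classical in
-- A closed trail has an even number of edges at `z`, so the bound `2n + 1` is as good as `2n`. The
-- trivial walk has no edges yet counts one visit, hence `hn1`.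
theorem visits_le [G.Loopless] (hst : ∀ e ∈ E(G), G.IsLink e (s e) (t e)) {K : Finset β} {x : α}
    (p : G.Walk x x) (hp : p.IsTrail) (hpK : ∀ e ∈ p.edges, e ∈ K) {n : ℕ} {z : α}
    (hn : (starEdges s t K z).card ≤ 2 * n + 1) (hn1 : p.edges = [] → 1 ≤ n) : p.visits z ≤ n := by
  by_cases h : p.edges = []
  · have h1 : p.visits z ≤ 1 := by
      rw [visits, if_pos h]
      cases p with
      | nil _ => exact List.count_le_length
      | cons => simp [edges] at h
    exact h1.trans (hn1 h)
  · have h1 := two_mul_visits hst p h z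
    rw [← card_star_edges hp] at h1
    have h2 : starEdges s t p.edges.toFinset z ⊆ starEdges s t K z :=
      Finset.filter_subset_filter _ fun f hf => hpK f (List.mem_toFinset.1 hf)
    have := Finset.card_le_card h2
    omega

end Walk

end Graph

/-! ### The matching gadget and Tutte's condition. -/

namespace EdgeCount

variable {α : Type*} {β : Type*} [DecidableEq α] [DecidableEq β] (s t : β → α)

/-- One of the two ends of an edge. -/
def endOf (e : β) (i : Bool) : α := if i then t e else s e

/-- Indices of the auxiliary vertices of `gadget`: twice `⌊d/3⌋` at a vertex of degree `d`. -/
def extra (E : Finset β) (V : Finset α) : Finset (Σ _ : α, ℕ) :=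
  V.sigma fun v => Finset.range (2 * ((starEdges s t E v).card / 3))

/-- A graph whose perfect matchings describe the edge sets `J ⊆ E` with
`d_J(v) ≤ d(v) - 2⌊d(v)/3⌋` and `d_J(v) ≡ d(v)` modulo two: its vertices are the half-edges and the
auxiliary vertices; half-edges at a common vertex and the two halves of an edge are adjacent, and
every auxiliary vertex at `v` is adjacent to the half-edges at `v`. -/
def gadget (E : Finset β) (V : Finset α) :
    SimpleGraph ((↥E × Bool) ⊕ ↥(extra s t E V)) where
  Adj
    | .inl (e, i), .inl (f, j) => e = f ∧ i ≠ j ∨ e ≠ f ∧ endOf s t e i = endOf s t f j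
    | .inl (e, i), .inr p => endOf s t e i = p.1.1
    | .inr p, .inl (e, i) => endOf s t e i = p.1.1
    | .inr _, .inr _ => False
  symm := ⟨by
    rintro (⟨e, i⟩ | p) (⟨f, j⟩ | q) h
    · rcases h with ⟨h1, h2⟩ | ⟨h1, h2⟩
      · exact Or.inl ⟨h1.symm, h2.symm⟩
      · exact Or.inr ⟨h1.symm, h2.symm⟩
    · exact h
    · exact h
    · exact h⟩
  loopless := ⟨by
    rintro (⟨e, i⟩ | p) h
    · rcases h with ⟨-, h⟩ | ⟨h, -⟩ <;> exact h rfl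
    · exact h⟩

variable {s t}

theorem gadget_adj_inl {E : Finset β} {V : Finset α} {e f : ↥E} {i j : Bool} :
    (gadget s t E V).Adj (.inl (e, i)) (.inl (f, j)) ↔
      (e = f ∧ i ≠ j ∨ e ≠ f ∧ endOf s t e i = endOf s t f j) := Iff.rfl

theorem gadget_adj_inl_inr {E : Finset β} {V : Finset α} {e : ↥E} {i : Bool}
    {p : ↥(extra s t E V)} :
    (gadget s t E V).Adj (.inl (e, i)) (.inr p) ↔ endOf s t e i = p.1.1 := Iff.rfl

theorem gadget_adj_inr {E : Finset β} {V : Finset α} {p q : ↥(extra s t E V)} :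
    ¬(gadget s t E V).Adj (.inr p) (.inr q) := id

theorem even_card_gadget (E : Finset β) (V : Finset α) :
    Even (Fintype.card ((↥E × Bool) ⊕ ↥(extra s t E V))) := by
  rw [Fintype.card_sum, Fintype.card_prod, Fintype.card_bool, Fintype.card_coe, Fintype.card_coe,
    extra, Finset.card_sigma]
  refine (even_two.mul_left _).add (Finset.even_sum _ fun v _ => ?_)
  rw [Finset.card_range]
  exact even_two_mul _

/-- Tutte's condition, with `κ` standing for the components left by deleting `U`. Surviving
half-edges at one vertex share a label, so the sets `X γ` are disjoint, and each one that is
nonempty and not `V` has at least three leaving edges. A label without half-edges sits on an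
auxiliary vertex at some `v ∈ A`, where all half-edges were deleted, which bounds their number by `∑
2⌊d/3⌋`. -/
theorem card_label_le {E : Finset β} {V : Finset α} (hE : ∀ e ∈ E, s e ∈ V ∧ t e ∈ V)
    (hloop : ∀ e ∈ E, s e ≠ t e)
    (hcut : ∀ X ⊆ V, X.Nonempty → X ≠ V → 3 ≤ (cut s t E X).card)
    {Γ : Type*} [Fintype Γ] (U : Finset ((↥E × Bool) ⊕ ↥(extra s t E V)))
    (κ : (↥E × Bool) ⊕ ↥(extra s t E V) → Γ) (hsurj : ∀ γ, ∃ w ∉ U, κ w = γ)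
    (hadj : ∀ a b, a ∉ U → b ∉ U → (gadget s t E V).Adj a b → κ a = κ b) :
    Fintype.card Γ ≤ max 1 U.card := by
  classical
  have endV : ∀ (e : ↥E) i, endOf s t e i ∈ V := by
    intro e i
    have := hE e e.2
    cases i
    · exact this.1
    · exact this.2
  have end_inj : ∀ (e : ↥E) i j, endOf s t e i = endOf s t e j → i = j := by
    intro e i j h
    have := hloop e e.2
    cases i <;> cases j
    · rfl
    · exact absurd h this
    · exact absurd h.symm this
    · rfl
  set A := V.filter fun v => ∀ (e : ↥E) i, endOf s t e i = v → .inl (e, i) ∈ U with hA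
  let X : Γ → Finset α := fun γ => V.filter fun v =>
    ∃ (e : ↥E) (i : Bool), endOf s t e i = v ∧ .inl (e, i) ∉ U ∧ κ (.inl (e, i)) = γ
  have memX : ∀ {γ v}, v ∈ X γ ↔ v ∈ V ∧
    ∃ (e : ↥E) (i : Bool), endOf s t e i = v ∧ .inl (e, i) ∉ U ∧ κ (.inl (e, i)) = γ := by
    intro γ v
    exact Finset.mem_filter
  have huniq : ∀ {γ γ' v}, v ∈ X γ → v ∈ X γ' → γ = γ' := by
    intro γ γ' v h h'
    obtain ⟨-, e, i, h1, h2, rfl⟩ := memX.1 h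
    obtain ⟨-, f, j, h4, h5, rfl⟩ := memX.1 h'
    by_cases hef : e = f
    · subst hef
      rw [end_inj e i j (h1.trans h4.symm)]
    · exact hadj _ _ h2 h5 (Or.inr ⟨hef, h1.trans h4.symm⟩)
  have hAX : ∀ {γ v}, v ∈ X γ → v ∉ A := by
    intro γ v h hvA
    obtain ⟨-, e, i, h1, h2, -⟩ := memX.1 h
    exact h2 ((Finset.mem_filter.1 hvA).2 e i h1)
  set C := (Finset.univ : Finset Γ).filter fun γ => (X γ).Nonempty with hC
  -- labels without half-edges
  have hN : ((Finset.univ : Finset Γ).filter fun γ => ¬(X γ).Nonempty).card ≤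
      ∑ v ∈ A, 2 * ((starEdges s t E v).card / 3) := by
    have h1 : ∀ γ, ¬(X γ).Nonempty → ∃ p : Σ _ : α, ℕ, ∃ h : p ∈ extra s t E V,
        p.1 ∈ A ∧ κ (.inr ⟨p, h⟩) = γ := by
      intro γ hγ
      obtain ⟨w, hw, rfl⟩ := hsurj γ
      rcases w with ⟨e, i⟩ | p
      · exact absurd ⟨_, memX.2 ⟨endV e i, e, i, rfl, hw, rfl⟩⟩ hγ
      · refine ⟨p.1, p.2, ?_, rfl⟩
        by_contra hpA
        have hpV : p.1.1 ∈ V := (Finset.mem_sigma.1 p.2).1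
        simp only [hA, Finset.mem_filter, not_and, not_forall] at hpA
        obtain ⟨e, i, h2, h3⟩ := hpA hpV
        exact hγ ⟨p.1.1, memX.2 ⟨hpV, e, i, h2, h3, hadj _ _ h3 hw h2⟩⟩
    rcases ((Finset.univ : Finset Γ).filter fun γ => ¬(X γ).Nonempty).eq_empty_or_nonempty with h0 | h0
    · rw [h0, Finset.card_empty]
      exact Nat.zero_le _
    obtain ⟨γ₁, hγ₁⟩ := h0
    have : Nonempty (Σ _ : α, ℕ) := ⟨(h1 γ₁ (Finset.mem_filter.1 hγ₁).2).choose⟩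
    choose! g hg using h1
    have h2 : ∑ v ∈ A, 2 * ((starEdges s t E v).card / 3) =
        (A.sigma fun v => Finset.range (2 * ((starEdges s t E v).card / 3))).card := by
      rw [Finset.card_sigma]
      simp
    rw [h2]
    refine Finset.card_le_card_of_injOn g ?_ ?_
    · intro γ hγ
      obtain ⟨h3, h4, h5⟩ := hg γ (Finset.mem_filter.1 hγ).2
      exact Finset.mem_sigma.2 ⟨h4, (Finset.mem_sigma.1 h3).2⟩
    · intro γ hγ γ' hγ' heq
      obtain ⟨h3, h4, h5⟩ := hg γ (Finset.mem_filter.1 hγ).2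
      obtain ⟨h6, h7, h8⟩ := hg γ' (Finset.mem_filter.1 hγ').2
      rw [← h5, ← h8]
      congr 3
  have hΓ : Fintype.card Γ = C.card + ((Finset.univ : Finset Γ).filter fun γ => ¬(X γ).Nonempty).card := by
    rw [hC, Finset.card_filter_add_card_filter_not]
    rfl
  by_cases hall : ∃ γ, X γ = V
  · obtain ⟨γ₀, hγ₀⟩ := hall
    refine le_max_of_le_left ?_
    have hA0 : A = ∅ := by
      refine Finset.eq_empty_of_forall_notMem fun v hv => ?_
      exact hAX (hγ₀ ▸ (Finset.mem_filter.1 hv).1 : v ∈ X γ₀) hv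
    rw [hA0, Finset.sum_empty] at hN
    have h1 : C.card ≤ 1 := by
      refine Finset.card_le_one.2 fun γ hγ γ' hγ' => ?_
      have key : ∀ {γ}, γ ∈ C → γ = γ₀ := by
        intro γ hγ
        obtain ⟨v, hv⟩ := (Finset.mem_filter.1 hγ).2
        exact huniq hv (hγ₀ ▸ (memX.1 hv).1)
      rw [key hγ, key hγ']
    omega
  · push Not at hall
    refine le_max_of_le_right ?_
    have h1 : 3 * C.card ≤ ∑ γ ∈ C, (cut s t E (X γ)).card := by
      rw [mul_comm, ← smul_eq_mul, ← Finset.sum_const]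
      exact Finset.sum_le_sum fun γ hγ => hcut _ (Finset.filter_subset _ _)
        (Finset.mem_filter.1 hγ).2 (hall γ)
    have h2 : ∑ γ ∈ C, (cut s t E (X γ)).card =
        ∑ e ∈ E, (C.filter fun γ => ¬(s e ∈ X γ ↔ t e ∈ X γ)).card := by
      simp only [cut]
      exact Finset.sum_card_bipartiteAbove_eq_sum_card_bipartiteBelow
        (fun γ e => ¬(s e ∈ X γ ↔ t e ∈ X γ))
    have h3 : ∑ v ∈ A, (starEdges s t E v).card =
        ∑ e ∈ E, ((if s e ∈ A then 1 else 0) + if t e ∈ A then 1 else 0) := by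
      rw [degree_sum hloop, cut, inner, Finset.card_filter, Finset.card_filter, Finset.mul_sum,
        ← Finset.sum_add_distrib]
      refine Finset.sum_congr rfl fun e _ => ?_
      by_cases h1 : s e ∈ A <;> by_cases h2 : t e ∈ A <;> simp [h1, h2]
    have h4 : ∑ e : ↥E, ((if .inl (e, false) ∈ U then 1 else 0) +
        if .inl (e, true) ∈ U then 1 else 0) ≤ U.card := by
      have h5 : ∑ e : ↥E, ((if .inl (e, false) ∈ U then 1 else 0) +
          if .inl (e, true) ∈ U then 1 else 0) =
          ((Finset.univ : Finset (↥E × Bool)).filter fun d => .inl d ∈ U).card := by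
        rw [Finset.card_filter, Fintype.sum_prod_type]
        refine Finset.sum_congr rfl fun e _ => ?_
        rw [Fintype.sum_bool, add_comm]
      rw [h5]
      exact Finset.card_le_card_of_injOn Sum.inl (fun d hd => (Finset.mem_filter.1 hd).2)
        Sum.inl_injective.injOn
    -- Each deleted half-edge pays three units: an edge pays one for every `X γ` that it leaves and
    -- two for every end in `A`. An edge with both halves intact leaves no `X γ`. The two units at
    -- `A` cover the labels there, as `3 · 2⌊d/3⌋ ≤ 2d`.
    have h6 : ∑ e ∈ E, ((C.filter fun γ => ¬(s e ∈ X γ ↔ t e ∈ X γ)).card +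
        2 * ((if s e ∈ A then 1 else 0) + if t e ∈ A then 1 else 0)) ≤
        3 * ∑ e : ↥E, ((if .inl (e, false) ∈ U then 1 else 0) +
        if .inl (e, true) ∈ U then 1 else 0) := by
      rw [← Finset.sum_coe_sort, Finset.mul_sum]
      refine Finset.sum_le_sum fun e _ => ?_
      have hsA : s e ∈ A → .inl (e, false) ∈ U := fun h => (Finset.mem_filter.1 h).2 e false rfl
      have htA : t e ∈ A → .inl (e, true) ∈ U := fun h => (Finset.mem_filter.1 h).2 e true rfl
      have one : ∀ v, (C.filter fun γ => v ∈ X γ).card ≤ if v ∈ A then 0 else 1 := by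
        intro v
        by_cases hv : v ∈ A
        · rw [if_pos hv, Nat.le_zero, Finset.card_eq_zero]
          exact Finset.filter_eq_empty_iff.2 fun γ _ h => hAX h hv
        · rw [if_neg hv]
          exact Finset.card_le_one.2 fun γ hγ γ' hγ' =>
            huniq (Finset.mem_filter.1 hγ).2 (Finset.mem_filter.1 hγ').2
      have h7 : (C.filter fun γ => ¬(s e ∈ X γ ↔ t e ∈ X γ)).card ≤
          (C.filter fun γ => s e ∈ X γ).card + (C.filter fun γ => t e ∈ X γ).card := by
        refine (Finset.card_le_card ?_).trans (Finset.card_union_le _ _)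
        intro γ
        simp only [Finset.mem_union, Finset.mem_filter]
        tauto
      have h8 := one (s e)
      have h9 := one (t e)
      by_cases hs : .inl (e, false) ∈ U
      · by_cases h10 : s e ∈ A <;> by_cases h11 : t e ∈ A <;>
          simp only [h10, h11, hs, htA, if_true, if_false] at h8 h9 ⊢ <;> (try split_ifs) <;> omega
      · have h10 : s e ∉ A := fun h => hs (hsA h)
        by_cases ht : .inl (e, true) ∈ U
        · by_cases h11 : t e ∈ A <;>
            simp only [h10, h11, hs, ht, if_true, if_false] at h8 h9 ⊢ <;> omega
        · have h11 : t e ∉ A := fun h => ht (htA h)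
          have h12 : (C.filter fun γ => ¬(s e ∈ X γ ↔ t e ∈ X γ)) = ∅ := by
            refine Finset.filter_eq_empty_iff.2 fun γ _ h => h ?_
            have hk : κ (.inl (e, false)) = κ (.inl (e, true)) :=
              hadj _ _ hs ht (Or.inl ⟨rfl, by simp⟩)
            have hsX : s e ∈ X (κ (.inl (e, false))) := memX.2 ⟨endV e false, e, false, rfl, hs, rfl⟩
            have htX : t e ∈ X (κ (.inl (e, false))) := memX.2 ⟨endV e true, e, true, rfl, ht, hk.symm⟩
            constructor
            · intro h
              rwa [huniq h hsX]
            · intro h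
              rwa [huniq h htX]
          simp [h12, h10, h11]
    rw [Finset.sum_add_distrib, ← h2, ← Finset.mul_sum, ← h3] at h6
    have h13 : 3 * ∑ v ∈ A, 2 * ((starEdges s t E v).card / 3) ≤
        2 * ∑ v ∈ A, (starEdges s t E v).card := by
      rw [Finset.mul_sum, Finset.mul_sum]
      exact Finset.sum_le_sum fun v _ => by omega
    omega

theorem exists_perfectMatching {E : Finset β} {V : Finset α} (hE : ∀ e ∈ E, s e ∈ V ∧ t e ∈ V)
    (hloop : ∀ e ∈ E, s e ≠ t e)
    (hcut : ∀ X ⊆ V, X.Nonempty → X ≠ V → 3 ≤ (cut s t E X).card) :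
    ∃ M : (gadget s t E V).Subgraph, M.IsPerfectMatching := by
  classical
  rw [SimpleGraph.tutte]
  intro U hU
  rw [SimpleGraph.IsTutteViolator] at hU
  set H := ((⊤ : (gadget s t E V).Subgraph).deleteVerts U).coe with hH
  have hfin : Finite H.ConnectedComponent := inferInstance
  let _ := Fintype.ofFinite H.ConnectedComponent
  have hpos : 0 < H.oddComponents.ncard := by omega
  obtain ⟨c₀, -⟩ := (Set.ncard_pos).1 hpos
  have hle : H.oddComponents.ncard ≤ Fintype.card H.ConnectedComponent := by
    rw [← Nat.card_eq_fintype_card, ← Set.ncard_univ]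
    exact Set.ncard_le_ncard (Set.subset_univ _)
  have hv : ∀ w, w ∉ U.toFinset → w ∈ ((⊤ : (gadget s t E V).Subgraph).deleteVerts U).verts := by
    intro w hw
    simpa using hw
  -- The value `c₀` on deleted vertices is a dummy.
  let κ : (↥E × Bool) ⊕ ↥(extra s t E V) → H.ConnectedComponent := fun w =>
    if h : w ∉ U.toFinset then H.connectedComponentMk ⟨w, hv w h⟩ else c₀
  have hκ : ∀ w (h : w ∉ U.toFinset), κ w = H.connectedComponentMk ⟨w, hv w h⟩ :=
    fun w h => dif_pos h
  have h1 := card_label_le hE hloop hcut U.toFinset κ (by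
    intro γ
    induction γ using SimpleGraph.ConnectedComponent.ind with
    | _ w =>
      have hw : w.1 ∉ U.toFinset := by simpa using w.2
      exact ⟨w.1, hw, hκ _ hw⟩) (by
    intro a b ha hb hab
    rw [hκ a ha, hκ b hb]
    refine SimpleGraph.ConnectedComponent.sound (SimpleGraph.Adj.reachable ?_)
    rw [hH, SimpleGraph.Subgraph.coe_adj, SimpleGraph.Subgraph.deleteVerts_adj]
    simp only [Set.mem_toFinset] at ha hb
    simp [ha, hb, hab])
  rw [← Set.ncard_eq_toFinset_card'] at h1
  -- More than `|U|` odd components but at most `max 1 |U|` in all leaves only `U = ∅` and a single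
  -- odd component, which the even order of the gadget excludes.
  have hU0 : U.ncard = 0 := by omega
  have hU1 : H.oddComponents.ncard = 1 := by omega
  have h2 := (SimpleGraph.odd_ncard_oddComponents H).1 (by rw [hU1]; exact odd_one)
  have hU2 : U = ∅ := (Set.ncard_eq_zero).1 hU0
  refine (Nat.not_odd_iff_even.2 (even_card_gadget (s := s) (t := t) E V)) ?_
  rw [← Nat.card_eq_fintype_card]
  convert h2 using 1
  subst hU2
  refine (Nat.card_congr (Equiv.subtypeUnivEquiv fun w => ?_)).symm
  simp

end EdgeCount

/-! ### Reading the edge set off a perfect matching. -/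

namespace EdgeCount

variable {α : Type*} {β : Type*} [DecidableEq α] [DecidableEq β] {s t : β → α}

/-- If all cuts have at least three edges, then removing a suitable edge set `J` leaves all degrees
even, and at least `2⌊d/3⌋` at a vertex of degree `d`. -/
theorem exists_odd_join {E : Finset β} {V : Finset α} (hE : ∀ e ∈ E, s e ∈ V ∧ t e ∈ V)
    (hloop : ∀ e ∈ E, s e ≠ t e)
    (hcut : ∀ X ⊆ V, X.Nonempty → X ≠ V → 3 ≤ (cut s t E X).card) :
    ∃ J ⊆ E, ∀ v ∈ V, Even ((starEdges s t E v).card + (starEdges s t J v).card) ∧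
      (starEdges s t J v).card + 2 * ((starEdges s t E v).card / 3) ≤ (starEdges s t E v).card := by
  classical
  obtain ⟨M, hM⟩ := exists_perfectMatching hE hloop hcut
  have hex : ∀ w, ∃ w', M.Adj w w' := fun w => (hM.1 (hM.2 w)).exists
  choose m hm using hex
  have huniq : ∀ {a b}, M.Adj a b → m a = b := fun {a b} h =>
    (hM.1 (hM.2 a)).unique (hm a) h
  have hmm : ∀ a, m (m a) = a := fun a => huniq (hm a).symm
  have hminj : Function.Injective m := fun a b h => by rw [← hmm a, h, hmm]
  have hadj : ∀ a, (gadget s t E V).Adj a (m a) := fun a => M.adj_sub (hm a)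
  -- `J` consists of the edges whose two halves are matched to each other. The other half-edges at
  -- `v` are matched either to the `2⌊d/3⌋` auxiliary vertices at `v` or in pairs among themselves.
  let Jp : ↥E → Prop := fun e => m (.inl (e, false)) = .inl (e, true)
  have hJp : ∀ (e : ↥E) i, m (.inl (e, i)) = .inl (e, !i) ↔ Jp e := by
    intro e i
    cases i
    · rfl
    · constructor
      · intro h
        change m (.inl (e, false)) = _
        rw [← hmm (.inl (e, true)), h]
        rfl
      · intro h
        change m (.inl (e, false)) = _ at h
        rw [← h, hmm]
        rfl
  refine ⟨((Finset.univ : Finset ↥E).filter Jp).map (Function.Embedding.subtype _), ?_, ?_⟩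
  · intro e he
    obtain ⟨f, -, rfl⟩ := Finset.mem_map.1 he
    exact f.2
  intro v hv
  set J := ((Finset.univ : Finset ↥E).filter Jp).map (Function.Embedding.subtype _) with hJ
  set S : Finset ↥E := (Finset.univ : Finset ↥E).filter fun e : ↥E => s e = v ∨ t e = v with hS
  let φ : ↥E → (↥E × Bool) ⊕ ↥(extra s t E V) := fun e => .inl (e, decide (t e = v))
  have hφ : ∀ e ∈ S, endOf s t e (decide (t e = v)) = v := by
    intro e he
    have h1 := (Finset.mem_filter.1 he).2
    by_cases h : t e = v
    · simp [endOf, h]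
    · simp [endOf, h, h1.resolve_right h]
  have hφ' : ∀ (e : ↥E) i, endOf s t e i = v → e ∈ S ∧ (.inl (e, i) : (↥E × Bool) ⊕ ↥(extra s t E V)) = φ e := by
    intro e i h
    have h1 := hloop e e.2
    cases i
    · have h2 : s e = v := h
      have h3 : t e ≠ v := fun h3 => h1 (h2.trans h3.symm)
      exact ⟨Finset.mem_filter.2 ⟨Finset.mem_univ _, Or.inl h2⟩, by simp [φ, h3]⟩
    · have h2 : t e = v := h
      exact ⟨Finset.mem_filter.2 ⟨Finset.mem_univ _, Or.inr h2⟩, by simp [φ, h2]⟩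
  have hφinj : Function.Injective φ := fun e f h => by
    have := Sum.inl_injective h
    exact (Prod.mk.inj this).1
  have hcardE : (starEdges s t E v).card = S.card := by
    rw [← Finset.card_map (Function.Embedding.subtype (· ∈ E))]
    congr 1
    ext e
    simp [mem_starEdges, hS, and_comm]
  have hcardJ : (starEdges s t J v).card = (S.filter Jp).card := by
    rw [← Finset.card_map (Function.Embedding.subtype (· ∈ E))]
    congr 1
    ext e
    simp only [mem_starEdges, hJ, hS, Finset.mem_map, Finset.mem_filter, Finset.mem_univ, true_and,
      Function.Embedding.subtype_apply]
    constructor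
    · rintro ⟨⟨f, h1, rfl⟩, h2⟩
      exact ⟨f, ⟨h2, h1⟩, rfl⟩
    · rintro ⟨f, ⟨h1, h2⟩, rfl⟩
      exact ⟨⟨f, h2, rfl⟩, h1⟩
  -- half-edges matched with auxiliary vertices
  have hcardD : (S.filter fun e => (m (φ e)).isRight).card = 2 * ((starEdges s t E v).card / 3) := by
    have h1 : (S.filter fun e => (m (φ e)).isRight).image (fun e => m (φ e)) =
        ((Finset.univ : Finset ↥(extra s t E V)).filter fun q => q.1.1 = v).image Sum.inr := by
      ext w
      simp only [Finset.mem_image, Finset.mem_filter, Finset.mem_univ, true_and]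
      constructor
      · rintro ⟨e, ⟨h2, h3⟩, rfl⟩
        obtain ⟨q, hq⟩ := Sum.isRight_iff.1 h3
        refine ⟨q, ?_, hq.symm⟩
        have h4 := hadj (φ e)
        rw [hq] at h4
        exact (gadget_adj_inl_inr.1 h4).symm.trans (hφ e h2)
      · rintro ⟨q, hq, rfl⟩
        have h4 := hadj (.inr q)
        rcases h5 : m (.inr q) with ⟨e, i⟩ | p
        · rw [h5] at h4
          obtain ⟨h6, h7⟩ := hφ' e i ((gadget_adj_inl_inr.1 h4.symm).trans hq)
          have h8 : m (φ e) = .inr q := by rw [← h7, ← h5, hmm]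
          exact ⟨e, ⟨h6, by rw [h8]; rfl⟩, h8⟩
        · rw [h5] at h4
          exact absurd h4 gadget_adj_inr
    rw [← Finset.card_image_of_injective (S.filter fun e => (m (φ e)).isRight) (hminj.comp hφinj),
      show (m ∘ φ) = fun e => m (φ e) from rfl, h1,
      Finset.card_image_of_injective _ Sum.inr_injective,
      ← Finset.card_map (Function.Embedding.subtype _),
      ← Finset.card_range (2 * ((starEdges s t E v).card / 3)),
      ← Finset.card_image_of_injective (Finset.range _)
        (sigma_mk_injective (β := fun _ : α => ℕ) (i := v))]
    congr 1
    ext p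
    simp only [Finset.mem_map, Finset.mem_filter, Finset.mem_univ, true_and, Finset.mem_image,
      Function.Embedding.subtype_apply]
    constructor
    · rintro ⟨⟨⟨w, i⟩, hp⟩, h2, rfl⟩
      dsimp only at h2
      subst h2
      exact ⟨i, (Finset.mem_sigma.1 hp).2, rfl⟩
    · rintro ⟨i, hi, rfl⟩
      exact ⟨⟨⟨v, i⟩, Finset.mem_sigma.2 ⟨hv, hi⟩⟩, rfl, rfl⟩
  -- half-edges matched with half-edges of other edges at the same vertex
  have heven : Even (S.filter fun e => ¬(m (φ e)).isRight ∧ ¬Jp e).card := by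
    let g : ↥E → ↥E := fun e => Sum.elim (fun d => d.1) (fun _ => e) (m (φ e))
    have hg : ∀ e ∈ S.filter (fun e => ¬(m (φ e)).isRight ∧ ¬Jp e),
        g e ∈ S ∧ m (φ e) = φ (g e) ∧ e ≠ g e := by
      intro e he
      obtain ⟨h1, h2, h3⟩ := Finset.mem_filter.1 he
      rcases h5 : m (φ e) with ⟨f, j⟩ | p
      · have hgf : g e = f := by simp [g, h5]
        have h4 := hadj (φ e)
        rw [h5] at h4
        rcases gadget_adj_inl.1 h4 with ⟨h6, h7⟩ | ⟨h6, h7⟩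
        · refine absurd ((hJp e (decide (t e = v))).1 ?_) h3
          change m (φ e) = _
          rw [h5, ← h6, Bool.eq_not_of_ne h7.symm]
        · have h8 := hφ' f j (h7.symm.trans (hφ e h1))
          rw [hgf]
          exact ⟨h8.1, h8.2, h6⟩
      · rw [h5] at h2
        exact absurd rfl h2
    rw [← ZMod.natCast_eq_zero_iff_even, Finset.card_eq_sum_ones, Nat.cast_sum]
    refine Finset.sum_involution (fun e _ => g e) (fun _ _ => by decide)
      (fun e he _ => (hg e he).2.2.symm) (fun e he => ?_) (fun e he => ?_)
    · obtain ⟨h1, h2, h3⟩ := hg e he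
      obtain ⟨-, -, h4⟩ := Finset.mem_filter.1 he
      have h5 : m (φ (g e)) = φ e := by rw [← h2, hmm]
      refine Finset.mem_filter.2 ⟨h1, by rw [h5]; simp [φ], fun h6 => ?_⟩
      have h7 : m (φ (g e)) = .inl (g e, !(decide (t (g e) = v))) := (hJp _ _).2 h6
      rw [h5] at h7
      exact h3 (Prod.mk.inj (Sum.inl_injective h7)).1
    · obtain ⟨h1, h2, h3⟩ := hg e he
      have h5 : m (φ (g e)) = φ e := by rw [← h2, hmm]
      change Sum.elim _ _ (m (φ (g e))) = e
      rw [h5]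
      rfl
  have hsplit : S.card = (S.filter Jp).card + (S.filter fun e => (m (φ e)).isRight).card +
      (S.filter fun e => ¬(m (φ e)).isRight ∧ ¬Jp e).card := by
    rw [Finset.card_filter Jp S, Finset.card_filter (fun e => (m (φ e)).isRight = true) S,
      Finset.card_filter (fun e => ¬(m (φ e)).isRight = true ∧ ¬Jp e) S, ← Finset.sum_add_distrib,
      ← Finset.sum_add_distrib, Finset.card_eq_sum_ones]
    refine Finset.sum_congr rfl fun e _ => ?_
    have h1 : Jp e → (m (φ e)).isRight = false := by
      intro h
      have : m (φ e) = _ := (hJp e (decide (t e = v))).2 h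
      rw [this]
      rfl
    by_cases h2 : Jp e
    · simp [h2, h1 h2]
    · by_cases h3 : (m (φ e)).isRight <;> simp [h2, h3]
  obtain ⟨r, hr⟩ := heven
  rw [hcardD, ← hcardJ, ← hcardE, hr] at hsplit
  refine ⟨Nat.even_iff.2 ?_, ?_⟩ <;> omega

end EdgeCount

/-! ### Doubling edges, and the three parts of the theorem. -/

namespace Graph

open EdgeCount

variable {α : Type u} {β : Type v} {G : Graph α β} {s t : β → α}

/-- The graph obtained from `G` by adding a parallel edge to every edge in `J`. -/
def doubling (G : Graph α β) (J : Set β) : Graph α (β × Bool) where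
  vertexSet := V(G)
  edgeSet := {e | e.1 ∈ E(G) ∧ (e.2 = true → e.1 ∈ J)}
  IsLink e x y := G.IsLink e.1 x y ∧ (e.2 = true → e.1 ∈ J)
  isLink_symm _ _ := { symm _ _ h := ⟨h.1.symm, h.2⟩ }
  eq_or_eq_of_isLink_of_isLink _ _ _ _ _ h h' := h.1.left_eq_or_eq h'.1
  edge_mem_iff_exists_isLink e := ⟨fun h => by
    obtain ⟨x, y, hxy⟩ := exists_isLink_of_mem_edgeSet h.1
    exact ⟨x, y, hxy, h.2⟩, fun ⟨_, _, h⟩ => ⟨h.1.edge_mem, h.2⟩⟩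
  left_mem_of_isLink _ _ _ h := h.1.left_mem

instance [G.Loopless] (J : Set β) : (G.doubling J).Loopless where
  not_isLoopAt e x h := Loopless.not_isLoopAt (G := G) e.1 x h.1

theorem finite_edgeSet_doubling (hE : E(G).Finite) (J : Set β) : E(G.doubling J).Finite :=
  (hE.prod (Set.toFinite (Set.univ : Set Bool))).subset fun _ he => ⟨he.1, Set.mem_univ _⟩

theorem doubling_ends (hst : ∀ e ∈ E(G), G.IsLink e (s e) (t e)) (J : Set β) :
    ∀ e ∈ E(G.doubling J), (G.doubling J).IsLink e (s e.1) (t e.1) :=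
  fun e he => ⟨hst e.1 he.1, he.2⟩

theorem card_filter_doubling [DecidableEq β] (hE : E(G).Finite) {J : Finset β}
    (hJ : J ⊆ hE.toFinset) (hE' : E(G.doubling J).Finite) (q : β → Prop) [DecidablePred q] :
    (hE'.toFinset.filter fun e => q e.1).card =
      (hE.toFinset.filter q).card + (J.filter q).card := by
  have h : (hE'.toFinset.filter fun e => q e.1) =
      (hE.toFinset.filter q) ×ˢ {false} ∪ (J.filter q) ×ˢ {true} := by
    ext ⟨e, i⟩
    have h1 : (e, i) ∈ hE'.toFinset ↔ e ∈ E(G) ∧ (i = true → e ∈ J) := by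
      rw [Set.Finite.mem_toFinset]
      rfl
    have h2 : e ∈ J → e ∈ E(G) := fun h => by simpa using hJ h
    rw [Finset.mem_filter, h1]
    cases i <;> simp
    tauto
  rw [h, Finset.card_union_of_disjoint, Finset.card_product, Finset.card_product]
  · simp
  · rw [Finset.disjoint_left]
    rintro ⟨e, i⟩ h1 h2
    simp only [Finset.mem_product, Finset.mem_singleton] at h1 h2
    rw [h1.2] at h2
    exact Bool.noConfusion h2.2

theorem exists_walk_of_doubling {J : Set β} {x y : α} (p : (G.doubling J).Walk x y) :
    ∃ q : G.Walk x y, q.support = p.support ∧ (q.edges = [] ↔ p.edges = []) := by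
  induction p with
  | nil hx => exact ⟨.nil hx, rfl, by simp [Walk.edges]⟩
  | cons e h p ih =>
    obtain ⟨q, hq, -⟩ := ih
    exact ⟨.cons e.1 h.1 q, by simp [Walk.support, hq], by simp [Walk.edges]⟩

theorem HasFTrail.hasFWalk_of_doubling {J : Set β} {f : α → ℤ} (h : (G.doubling J).HasFTrail f) :
    G.HasFWalk f := by
  obtain ⟨x, p, -, hs, hv⟩ := h
  obtain ⟨q, hq, hq'⟩ := exists_walk_of_doubling p
  refine ⟨x, q, fun z hz => hq ▸ hs z hz, fun z hz => ?_⟩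
  have : q.visits z = p.visits z := by
    simp only [Walk.visits, hq, hq']
  rw [this]
  exact hv z hz

open Classical in
theorem hasFTrail_of_connects [G.Loopless] (hV : V(G).Finite) (hne : V(G).Nonempty)
    (hst : ∀ e ∈ E(G), G.IsLink e (s e) (t e)) {K : Finset β} (hKE : ∀ e ∈ K, e ∈ E(G))
    (hK : Connects s t K hV.toFinset) (hev : ∀ v ∈ V(G), Even (starEdges s t K v).card) {f : α → ℤ}
    (hf : ∀ v ∈ V(G), 1 ≤ f v ∧ ((starEdges s t K v).card : ℤ) ≤ 2 * f v + 1) : G.HasFTrail f := by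
  obtain ⟨x, p, hp, hs, hpK⟩ := Walk.exists_spanning_closed_trail hV hne hst hKE hK hev
  refine ⟨x, p, hp, hs, fun z hz => ?_⟩
  obtain ⟨h1, h2⟩ := hf z hz
  have := Walk.visits_le hst p hp hpK (n := (f z).toNat) (z := z) (by omega) (fun _ => by omega)
  omega

open Classical in
theorem hasFTrail_of_le_card_cut [G.Loopless] (hV : V(G).Finite) (hE : E(G).Finite)
    (hne : V(G).Nonempty) (hst : ∀ e ∈ E(G), G.IsLink e (s e) (t e)) {k : ℕ} (hk : 4 ≤ k)
    (hcut : ∀ X ⊆ hV.toFinset, X.Nonempty → X ≠ hV.toFinset → k ≤ (cut s t hE.toFinset X).card)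
    {f : α → ℤ} (hf : ∀ v ∈ V(G), 1 ≤ f v ∧
      2 * ((starEdges s t hE.toFinset v).card : ℤ) + 4 * k ≤ k * (2 * f v + 1) + 8) :
    G.HasFTrail f := by
  obtain ⟨K, hKE, hK, hdeg⟩ := exists_connects_even_degree_le (s := s) (t := t) hk
    (V := hV.toFinset) (E := hE.toFinset) (by simpa using hne)
    (fun e he => by
      have := hst e (by simpa using he)
      simpa using ⟨this.left_mem, this.right_mem⟩)
    (fun e he => (hst e (by simpa using he)).ne) hcut (fun v => (2 * f v + 1).toNat)
    (fun v hv => by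
      obtain ⟨h1, h2⟩ := hf v (by simpa using hv)
      zify
      rw [Int.toNat_of_nonneg (by omega)]
      exact h2)
  refine hasFTrail_of_connects hV hne hst (fun e he => by simpa using hKE he) hK
    (fun v hv => (hdeg v (by simpa using hv)).1) fun v hv => ⟨(hf v hv).1, ?_⟩
  have h1 := (hdeg v (by simpa using hv)).2
  have h2 := (hf v hv).1
  omega

theorem Walk.exists_of_mem_support {x a b : α} (p : G.Walk x x) (ha : a ∈ p.support)
    (hb : b ∈ p.support) : Nonempty (G.Walk a b) := by
  obtain ⟨-, r, -⟩ := p.exists_split ha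
  obtain ⟨q, -, -⟩ := p.exists_split hb
  exact ⟨r.append q⟩

theorem ends_mem (hV : V(G).Finite) (hE : E(G).Finite) (hst : ∀ e ∈ E(G), G.IsLink e (s e) (t e)) :
    ∀ e ∈ hE.toFinset, s e ∈ hV.toFinset ∧ t e ∈ hV.toFinset := fun e he => by
  have := hst e (by simpa using he)
  simpa using ⟨this.left_mem, this.right_mem⟩

/-- Every `k`-edge-connected graph with `k ≥ 4` has a spanning closed trail meeting each vertex `v`
at most `⌈(d(v) + k/2 - 4) / k⌉ + 1` times. -/
theorem EdgeConnected.hasFTrail [G.Loopless] (hV : V(G).Finite) (hE : E(G).Finite) {k : ℕ}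
    (hk : 4 ≤ k) (hG : G.EdgeConnected k) :
    G.HasFTrail (fun x => ⌈((G.degree x : ℚ) + (k : ℚ) / 2 - 4) / (k : ℚ)⌉ + 1) := by
  classical
  have hne := hG.nonempty (by omega)
  obtain ⟨s, t, hst⟩ := exists_ends G hne
  refine hasFTrail_of_le_card_cut hV hE hne hst hk
    (fun X hX hXne hXV => hG.le_card_cut hV hE hst hX hXne hXV) fun v hv => ?_
  rw [← degree_eq_card_starEdges hE hst]
  have hk' : (4 : ℚ) ≤ k := by exact_mod_cast hk
  have hkpos : (0 : ℚ) < k := by linarith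
  set q := ⌈((G.degree v : ℚ) + (k : ℚ) / 2 - 4) / (k : ℚ)⌉ with hq
  have h1 := Int.le_ceil (((G.degree v : ℚ) + (k : ℚ) / 2 - 4) / (k : ℚ))
  rw [← hq, div_le_iff₀ hkpos] at h1
  have h2 : (2 * (G.degree v : ℤ) + k - 8 : ℤ) ≤ 2 * (q * k) := by
    have : (2 * (G.degree v : ℚ) + k - 8) ≤ 2 * (q * k) := by linarith
    exact_mod_cast this
  constructor
  · have h3 : (-1 : ℤ) < q := by
      rw [hq, Int.lt_ceil, lt_div_iff₀ hkpos]
      have : (0 : ℚ) ≤ G.degree v := Nat.cast_nonneg _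
      push_cast
      linarith
    omega
  · nlinarith

/-- Every `k`-edge-connected graph with `k ≤ 3` has a spanning closed walk meeting each vertex `v`
at most `⌈(d(v) - 1) / k⌉ + 1` times. -/
theorem EdgeConnected.hasFWalk [G.Loopless] (hV : V(G).Finite) (hE : E(G).Finite) {k : ℕ}
    (hk1 : 1 ≤ k) (hk3 : k ≤ 3) (hnt : k = 1 → V(G).Nontrivial) (hG : G.EdgeConnected k) :
    G.HasFWalk (fun x => ⌈((G.degree x : ℚ) - 1) / (k : ℚ)⌉ + 1) := by
  classical
  have hne := hG.nonempty (by omega)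
  obtain ⟨s, t, hst⟩ := exists_ends G hne
  have hcut := fun X hX hXne hXV => hG.le_card_cut hV hE hst (X := X) hX hXne hXV
  have hkpos : (0 : ℚ) < k := by exact_mod_cast hk1
  have hceil : ∀ v, (G.degree v : ℤ) - 1 ≤ ⌈((G.degree v : ℚ) - 1) / (k : ℚ)⌉ * k := by
    intro v
    have h1 := Int.le_ceil (((G.degree v : ℚ) - 1) / (k : ℚ))
    rw [div_le_iff₀ hkpos] at h1
    exact_mod_cast h1
  have hdeg := fun v => degree_eq_card_starEdges hE hst v
  have hloop : ∀ e ∈ hE.toFinset, s e ≠ t e := fun e he => (hst e (by simpa using he)).ne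
  -- degrees and cuts after doubling
  have hstar : ∀ {J : Finset β} (_ : J ⊆ hE.toFinset) v,
      (starEdges (fun e : β × Bool => s e.1) (fun e => t e.1)
        (finite_edgeSet_doubling hE (J : Set β)).toFinset v).card =
      G.degree v + (starEdges s t J v).card := fun hJ v => by
    rw [hdeg]
    exact card_filter_doubling hE hJ _ (fun e => s e = v ∨ t e = v)
  have hcut' : ∀ {J : Finset β} (_ : J ⊆ hE.toFinset) X,
      (cut (fun e : β × Bool => s e.1) (fun e => t e.1)
        (finite_edgeSet_doubling hE (J : Set β)).toFinset X).card =
      (cut s t hE.toFinset X).card + (cut s t J X).card := fun hJ X =>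
    card_filter_doubling hE hJ _ (fun e => ¬(s e ∈ X ↔ t e ∈ X))
  -- This is the case `k = 4` of the trail bound for the doubled graph: `2(d + d_J) + 16 ≤ 4(2f + 1)
  -- + 8` reduces to `d + d_J + 2 ≤ 4f`.
  have main : ∀ {J : Finset β} (_ : J ⊆ hE.toFinset),
      (∀ X ⊆ hV.toFinset, X.Nonempty → X ≠ hV.toFinset →
        4 ≤ (cut s t hE.toFinset X).card + (cut s t J X).card) →
      (∀ v ∈ V(G), 1 ≤ ⌈((G.degree v : ℚ) - 1) / (k : ℚ)⌉ + 1 ∧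
        (G.degree v + (starEdges s t J v).card : ℤ) + 2 ≤
          4 * (⌈((G.degree v : ℚ) - 1) / (k : ℚ)⌉ + 1)) →
      G.HasFWalk (fun x => ⌈((G.degree x : ℚ) - 1) / (k : ℚ)⌉ + 1) := by
    intro J hJ hc hd
    refine HasFTrail.hasFWalk_of_doubling (J := (J : Set β))
      (hasFTrail_of_le_card_cut (G := G.doubling J) hV (finite_edgeSet_doubling hE J) hne (doubling_ends hst J) le_rfl
      (fun X hX hXne hXV => ?_) fun v hv => ⟨(hd v hv).1, ?_⟩)
    · rw [hcut' hJ]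
      exact hc X hX hXne hXV
    · rw [hstar hJ]
      have := (hd v hv).2
      push_cast
      omega
  obtain rfl | rfl | rfl : k = 1 ∨ k = 2 ∨ k = 3 := by omega
  · have hstarE := fun v => (hstar (subset_refl hE.toFinset) v).trans
      (congrArg (G.degree v + ·) (hdeg v).symm)
    refine HasFTrail.hasFWalk_of_doubling (J := (hE.toFinset : Set β))
      (hasFTrail_of_connects (G := G.doubling (hE.toFinset : Set β)) hV hne (doubling_ends hst _)
        (K := (finite_edgeSet_doubling hE (hE.toFinset : Set β)).toFinset) (fun e he => by simpa using he)
        (fun X hX hXne hXV => ?_) (fun v _ => ?_) fun v hv => ?_)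
    · have := hcut X hX hXne hXV
      rw [← Finset.card_pos, hcut' subset_rfl]
      omega
    · rw [hstarE]
      exact ⟨_, rfl⟩
    · rw [hstarE]
      -- Here the second vertex matters: on a single vertex `f` would be 0, while the trivial walk
      -- makes one visit.
      have h1 : 1 ≤ G.degree v := by
        obtain ⟨w, hw, hwv⟩ := (hnt rfl).exists_ne v
        have hv' : v ∈ V(G) := hv
        have h2 := hcut {v} (by simpa using hv') (Finset.singleton_nonempty v) (fun h => by
          have : w ∈ ({v} : Finset α) := h ▸ (by simpa using hw)
          exact hwv (Finset.mem_singleton.1 this))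
        refine h2.trans ?_
        rw [hdeg]
        refine Finset.card_le_card fun e he => ?_
        simp only [mem_cut, mem_starEdges, Finset.mem_singleton] at he ⊢
        tauto
      have h2 := hceil v
      push_cast at h2 ⊢
      omega
  · refine main subset_rfl (fun X hX hXne hXV => ?_) fun v _ => ?_
    · have := hcut X hX hXne hXV
      omega
    · rw [← hdeg]
      have := hceil v
      push_cast at this ⊢
      omega
  · obtain ⟨J, hJ, hJd⟩ := exists_odd_join (ends_mem hV hE hst) hloop hcut
    refine main hJ (fun X hX hXne hXV => ?_) fun v hv => ?_
    · have h1 := hcut X hX hXne hXV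
      have h2 := degree_sum hloop X
      have h3 := degree_sum (s := s) (t := t) (fun e he => hloop e (hJ he)) X
      -- A cut has the parity of the degree sum over its side, so every cut is even after doubling
      -- `J`, and at least 3 means at least 4.
      have h4 : Even (∑ v ∈ X, ((starEdges s t hE.toFinset v).card + (starEdges s t J v).card)) :=
        Finset.even_sum _ fun v hv => (hJd v (hX hv)).1
      rw [Finset.sum_add_distrib, h2, h3] at h4
      have := Nat.even_iff.1 h4
      omega
    · have h1 := (hJd v (by simpa using hv)).2
      rw [← hdeg] at h1
      have := hceil v
      push_cast at this ⊢
      omega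

/-- Every `r`-regular `r`-edge-connected graph with `4 ≤ r ≤ 8` has a connected `{2, 4}`-factor. -/
theorem EdgeConnected.exists_connected_factor [G.Loopless] (hV : V(G).Finite) (hE : E(G).Finite)
    {r : ℕ} (hr4 : 4 ≤ r) (hr8 : r ≤ 8) (hG : G.EdgeConnected r) (hreg : G.IsRegular r) :
    ∃ H : Graph α β, H.IsFactor G {2, 4} ∧ H.Connected := by
  classical
  have hne := hG.nonempty (by omega)
  obtain ⟨s, t, hst⟩ := exists_ends G hne
  have hdeg := fun v => degree_eq_card_starEdges hE hst v
  obtain ⟨K, hKE, hK, hKd⟩ := exists_connects_even_degree_le (s := s) (t := t) hr4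
    (V := hV.toFinset) (E := hE.toFinset) (by simpa using hne) (ends_mem hV hE hst)
    (fun e he => (hst e (by simpa using he)).ne)
    -- With `d = k = r`, the bound 5 is admissible when `6r ≤ 5r + 8`, which is `r ≤ 8`. Even
    -- degrees at most 5 are 0, 2 or 4, and connectedness excludes 0.
    (fun X hX hXne hXV => hG.le_card_cut hV hE hst hX hXne hXV) (fun _ => 5)
    (fun v hv => by
      rw [← hdeg, hreg v (by simpa using hv)]
      omega)
  have hKE' : ∀ e ∈ K, e ∈ E(G) := fun e he => by simpa using hKE he
  set H := G.restrict (K : Set β) with hH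
  have hHst : ∀ e ∈ E(H), H.IsLink e (s e) (t e) := fun e he => by
    rw [hH, edgeSet_restrict] at he
    rw [hH, restrict_isLink]
    exact ⟨he.2, hst e he.1⟩
  have hHE : E(H) = (K : Set β) := by
    rw [hH, edgeSet_restrict]
    exact Set.inter_eq_right.2 hKE'
  have hHfin : E(H).Finite := hHE ▸ K.finite_toSet
  have hHloop : H.Loopless := ⟨fun e x h => Loopless.not_isLoopAt (G := G) e x
    (by
      have h1 : H.IsLink e x x := h
      rw [hH, restrict_isLink] at h1
      exact h1.2)⟩
  have hHdeg : ∀ v, H.degree v = (starEdges s t K v).card := fun v => by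
    rw [degree_eq_card_starEdges hHfin hHst]
    congr 2
    ext e
    rw [Set.Finite.mem_toFinset, hHE, Finset.mem_coe]
  refine ⟨H, ⟨⟨restrict_le, rfl⟩, fun v hv => ?_⟩, hne, fun x hx y hy => ?_⟩
  · have hv' : v ∈ V(G) := hv
    obtain ⟨⟨m, hm⟩, h5⟩ := hKd v (by simpa using hv')
    have hpos : 0 < (starEdges s t hE.toFinset v).card := by
      rw [← hdeg, hreg v hv']
      omega
    obtain ⟨e, he⟩ := Finset.card_pos.1 hpos
    rw [mem_starEdges] at he
    have hne' := (hst e (by simpa using he.1)).ne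
    have hends := ends_mem hV hE hst e he.1
    obtain ⟨f, hf⟩ := hK {v} (by simpa using hv') (Finset.singleton_nonempty v) (fun h => by
      rw [← h, Finset.mem_singleton, Finset.mem_singleton] at hends
      exact hne' (hends.1.trans hends.2.symm))
    have hf' : f ∈ starEdges s t K v := by
      simp only [mem_cut, mem_starEdges, Finset.mem_singleton] at hf ⊢
      tauto
    have := Finset.card_pos.2 ⟨f, hf'⟩
    rw [hHdeg]
    simp only [Set.mem_insert_iff, Set.mem_singleton_iff]
    omega
  · obtain ⟨a, p, -, hs, -⟩ := Walk.exists_spanning_closed_trail (G := H) hV hne hHst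
      (K := K) (fun e he => by rw [hHE]; exact he) hK
      (fun v hv => (hKd v (by simpa using (show v ∈ V(G) from hv))).1)
    exact p.exists_of_mem_support (hs x hx) (hs y hy)

end Graph

theorem mainTheorem12 {α : Type u} {β : Type v} (G : Graph α β) [G.Loopless]
    (hV : V(G).Finite) (hE : E(G).Finite) :
    (∀ k : ℕ, 4 ≤ k → G.EdgeConnected k →
      G.HasFTrail (fun x => ⌈((G.degree x : ℚ) + (k : ℚ) / 2 - 4) / (k : ℚ)⌉ + 1)) ∧
    (∀ k : ℕ, 1 ≤ k → k ≤ 3 → (k = 1 → V(G).Nontrivial) → G.EdgeConnected k →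
      G.HasFWalk (fun x => ⌈((G.degree x : ℚ) - 1) / (k : ℚ)⌉ + 1)) ∧
    (∀ r : ℕ, 4 ≤ r → r ≤ 8 → G.EdgeConnected r → G.IsRegular r →
      ∃ H : Graph α β, H.IsFactor G {2, 4} ∧ H.Connected) :=
  ⟨fun _ hk hG => hG.hasFTrail hV hE hk,
    fun _ hk1 hk3 hnt hG => hG.hasFWalk hV hE hk1 hk3 hnt,
    fun _ hr4 hr8 hG hreg => hG.exists_connected_factor hV hE hr4 hr8 hreg⟩
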